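/- Theorem. Let $T>0$ and let $\mathbb D=\mathbb D([0,T])$ be the space of càdlàg functions $x:[0,T]\to\mathbb R$ (right-continuous on $[0,T)$, with left limits on $(0,T]$). For $v:[0,T]\to\mathbb R$ put $\|v\|(T)=\sup\{|v(0)|+\sum_{i=1}^m|v(t_i)-v(t_{i-1})|\}$, the supremum being over all partitions $0=t_0<t_1<\dots<t_m=T$, and let $\mathbb V=\{v\in\mathbb D:\|v\|(T)<\infty\}$. For $v_n\in\mathbb V$, $n=0,1,2,\dots$, write $v_n\Rightarrow v_0$ if $\int_{[0,T]}f\,dv_n\to\int_{[0,T]}f\,dv_0$ for every continuous $f:[0,T]\to\mathbb R$, where $dv$ is the finite signed measure on $[0,T]$ with $dv([0,t])=v(t)$ (in particular, $dv$ has mass $v(0)$ at $0$). For $x_n\in\mathbb D$, $n=0,1,2,\dots$, write $x_n\to_S x_0$ if for every $\varepsilon>0$ there are $v_{n,\varepsilon}\in\mathbb V$, $n=0,1,2,\dots$, with $\sup_{t\in[0,T]}|x_n(t)-v_{n,\varepsilon}(t)|\le\varepsilon$ for all $n\ge 0$ and $v_{n,\varepsilon}\Rightarrow v_{0,\varepsilon}$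 as $n\to\infty$. The $S$ topology on $\mathbb D$ is the topology whose closed sets are the sets $F\subset\mathbb D$ such that $x_n\in F$ for all $n\ge1$ and $x_n\to_S x_0$ imply $x_0\in F$. Write $x_n\xrightarrow{*}_S x_0$ if $x_n$ converges to $x_0$ in the $S$ topology, that is, if every $S$-open set containing $x_0$ contains $x_n$ for all sufficiently large $n$. Let $\mathbb A$ be the set of continuous functions $A:[0,T]\to\mathbb R$ with $\|A\|(T)<\infty$ and $A(0)=0$. For $A_n\in\mathbb A$, $n=0,1,2,\dots$, write $A_n\to_\tau A_0$ if $\sup_{t\in[0,T]}|A_n(t)-A_0(t)|\to0$ and $\sup_n\|A_n\|(T)<\infty$. Let $x_0,x_1,x_2,\dots\in\mathbb D$. Then $x_n\xrightarrow{*}_S x_0$ if and only if $x_n(T)\to x_0(T)$ and $$\int_0^T x_n(t)\,dA_n(t)\to\int_0^T x_0(t)\,dA_0(t)$$ for all $A_0,A_1,A_2,\dots\in\mathbb A$ such that $A_n\to_\tau A_0$. -/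

import Mathlib

open Set Filter Topology MeasureTheory
open scoped ENNReal

noncomputable section

/-- The Skorokhod space `𝔻([0,T])` of real càdlàg functions on `[0,T]`.
All neighbourhood filters are those of the subspace `[0,T]`, so that right-continuity is an empty
condition at `T`, and so is the existence of a left limit at `0`. -/
structure SkorokhodSpace (T : ℝ) where
  /-- the underlying function -/
  toFun : Icc (0 : ℝ) T → ℝ
  right_continuous : ∀ t, ContinuousWithinAt toFun (Ici t) t
  left_limits : ∀ t, ∃ l : ℝ, Tendsto toFun (𝓝[<] t) (𝓝 l)

namespace SkorokhodSpace

instance (T : ℝ) : CoeFun (SkorokhodSpace T) (fun _ => Icc (0 : ℝ) T → ℝ) := ⟨toFun⟩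

/-- The point `0` of `[0,T]`. -/
def start {T : ℝ} (hT : 0 < T) : Icc (0 : ℝ) T := ⟨0, left_mem_Icc.2 hT.le⟩

/-- The point `T` of `[0,T]`. -/
def final {T : ℝ} (hT : 0 < T) : Icc (0 : ℝ) T := ⟨T, right_mem_Icc.2 hT.le⟩

/-- The total variation `‖v‖(T) = |v(0)| + sup ∑ |v(tᵢ) - v(tᵢ₋₁)|`, in `[0,∞]`. -/
def totalVariation {T : ℝ} (hT : 0 < T) (v : Icc (0 : ℝ) T → ℝ) : ℝ≥0∞ :=
  ‖v (start hT)‖ₑ + eVariationOn v univ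

theorem boundedVariationOn_of_totalVariation_lt_top {T : ℝ} (hT : 0 < T) {v : Icc (0 : ℝ) T → ℝ}
    (hv : totalVariation hT v < ∞) : BoundedVariationOn v univ :=
  (lt_of_le_of_lt le_add_self hv).ne

instance (T : ℝ) : CompactIccSpace (Icc (0 : ℝ) T) where
  isCompact_Icc {_ _} := isClosed_Icc.isCompact

/-- The Stieltjes integral `∫_{[0,T]} f dv` for a right-continuous `v` of finite variation. By the
convention `v(0-) = 0` (the one for which `|v(0)|` is a part of `‖v‖(T)`), `dv` has the mass `v(0)`
at the point `0`; `BoundedVariationOn.vectorMeasure` is the signed measure that has mass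
`v(b) - v(a)` on `(a,b]` and no mass at `0`. -/
def stieltjesIntegral {T : ℝ} (hT : 0 < T) (f v : Icc (0 : ℝ) T → ℝ)
    (hv : totalVariation hT v < ∞) : ℝ :=
  f (start hT) * v (start hT) +
    ∫ᵛ t, f t ∂•(boundedVariationOn_of_totalVariation_lt_top hT hv).vectorMeasure

/-- The space `𝕍` of càdlàg functions of finite variation on `[0,T]`. -/
structure FiniteVariation {T : ℝ} (hT : 0 < T) extends SkorokhodSpace T where
  finite_variation : totalVariation hT toFun < ∞

/-- Weak-* convergence `vₙ ⇒ v₀` in `𝕍`: convergence of the integrals of every continuous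
function on `[0,T]`. -/
def WeakStarConv {T : ℝ} {hT : 0 < T} (v : ℕ → FiniteVariation hT) (v₀ : FiniteVariation hT) :
    Prop :=
  ∀ f : Icc (0 : ℝ) T → ℝ, Continuous f →
    Tendsto (fun n => stieltjesIntegral hT f (v n).toFun (v n).finite_variation) atTop
      (𝓝 (stieltjesIntegral hT f v₀.toFun v₀.finite_variation))

/-- `S`-convergence (a priori): for every `ε > 0` there are `vₙ, v₀` in `𝕍` that are uniformly
`ε`-close to `xₙ, x₀` and such that `vₙ ⇒ v₀`. -/
def SConv {T : ℝ} (hT : 0 < T) (x : ℕ → SkorokhodSpace T) (x₀ : SkorokhodSpace T) : Prop :=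
  ∀ ε : ℝ, 0 < ε → ∃ (v : ℕ → FiniteVariation hT) (v₀ : FiniteVariation hT),
    (∀ n t, |x n t - (v n).toFun t| ≤ ε) ∧ (∀ t, |x₀ t - v₀.toFun t| ≤ ε) ∧ WeakStarConv v v₀

theorem SConv.subseq {T : ℝ} {hT : 0 < T} {x : ℕ → SkorokhodSpace T} {x₀ : SkorokhodSpace T}
    (h : SConv hT x x₀) {φ : ℕ → ℕ} (hφ : StrictMono φ) : SConv hT (fun k => x (φ k)) x₀ := by
  intro ε hε
  obtain ⟨v, v₀, h1, h2, h3⟩ := h ε hε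
  exact ⟨fun k => v (φ k), v₀, fun n t => h1 (φ n) t, h2,
    fun f hf => (h3 f hf).comp hφ.tendsto_atTop⟩

/-- A set is closed for the `S` topology if it contains the limits of all `S`-convergent sequences
of its elements. -/
def SClosed {T : ℝ} (hT : 0 < T) (F : Set (SkorokhodSpace T)) : Prop :=
  ∀ (x : ℕ → SkorokhodSpace T) (x₀ : SkorokhodSpace T),
    (∀ n, x n ∈ F) → SConv hT x x₀ → x₀ ∈ F

/-- The `S` topology: the sequential topology generated by `S`-convergence. -/
@[reducible] def sTopology {T : ℝ} (hT : 0 < T) : TopologicalSpace (SkorokhodSpace T) :=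
  TopologicalSpace.ofClosed {F | SClosed hT F}
    (fun _ _ h _ => absurd (h 0) (notMem_empty _))
    (fun _ hA x x₀ hx hc F hF => hA hF x x₀ (fun n => hx n F hF) hc)
    (by
      intro F hF G hG x x₀ hx hc
      by_cases h : ∃ᶠ n in atTop, x n ∈ F
      · obtain ⟨φ, hφ, hφF⟩ := extraction_of_frequently_atTop h
        exact Or.inl (hF _ x₀ hφF (hc.subseq hφ))
      · have h' : ∃ᶠ n in atTop, x n ∈ G :=
          ((not_frequently.1 h).mono fun n hn => (hx n).resolve_left hn).frequently
        obtain ⟨φ, hφ, hφG⟩ := extraction_of_frequently_atTop h'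
        exact Or.inr (hG _ x₀ hφG (hc.subseq hφ)))

/-- Convergence a posteriori: convergence of sequences in the `S` topology. -/
def SStarConv {T : ℝ} (hT : 0 < T) (x : ℕ → SkorokhodSpace T) (x₀ : SkorokhodSpace T) : Prop :=
  Tendsto x atTop (@nhds (SkorokhodSpace T) (sTopology hT) x₀)

/-- The family `𝔸` of continuous functions `A` of finite variation on `[0,T]` with `A(0) = 0`. -/
structure ContinuousFV {T : ℝ} (hT : 0 < T) where
  /-- the underlying function -/
  toFun : Icc (0 : ℝ) T → ℝ
  continuous_toFun : Continuous toFun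
  finite_variation : totalVariation hT toFun < ∞
  map_start : toFun (start hT) = 0

/-- `Aₙ →_τ A₀`: uniform convergence with uniformly bounded total variations. -/
def TauConv {T : ℝ} {hT : 0 < T} (A : ℕ → ContinuousFV hT) (A₀ : ContinuousFV hT) : Prop :=
  TendstoUniformly (fun n => (A n).toFun) A₀.toFun atTop ∧
    (⨆ n, totalVariation hT (A n).toFun) < ∞

/-- `∫_0^T x(t) dA(t)` for a càdlàg `x` and `A ∈ 𝔸`. -/
def integralAgainst {T : ℝ} {hT : 0 < T} (x : SkorokhodSpace T) (A : ContinuousFV hT) : ℝ :=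
  stieltjesIntegral hT x.toFun A.toFun A.finite_variation

end SkorokhodSpace

end

/-!
Write `dv` for the signed measure with distribution function `v`. A function `A ∈ 𝔸` has no atoms,
so Fubini's theorem on `{(s, t) | t ≤ s}` gives the integration by parts
`∫ v dA = v(T) A(T) - ∫ A dv` for `v ∈ 𝕍` (`stieltjesIntegral_by_parts`). It makes `𝕍` with weak-*
convergence and `𝔸` with `τ`-convergence dual to each other. The estimate
`|∫ f dA| ≤ sup |f| · ‖A‖(T)` allows to pass from `𝕍` to its uniform limits. Integration against
the steep ramps `ramp t m` tends to evaluation at `t < T` as `m → ∞`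
(`tendsto_integralAgainst_ramp`), so a càdlàg function is determined by its integrals and its
value at `T`.

*Convergence in the `S` topology implies convergence of the integrals.* If `vₙ ⇒ v₀`, the norms of
the functionals `dvₙ` are bounded by the uniform boundedness principle, so `∫ Aₙ dvₙ → ∫ A₀ dv₀`
whenever `Aₙ` tends to `A₀` uniformly. Integration by parts and uniform approximation give the
convergence of `∫ xₙ dAₙ` when `xₙ →_S x₀` (`SConv.tendsto_integralAgainst`). In particular limits
for `→_S` are unique, in a way that is detected by functionals continuous for the `S` topology;
hence a sequence converging in the `S` topology has an `→_S`-convergent subsequence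
(`SStarConv.exists_subseq_sConv`), and this suffices.

*Convergence of the integrals implies convergence in the `S` topology.* It is enough to find an
`→_S`-convergent subsequence. Any `x ∈ 𝔻` is within `ε` of the step function that follows the
successive times at which `x` has moved by `ε` (`crossing`), which are finitely many. Testing the
integrals on `Aₙ →_τ 0` yields that `∫ xₙ dA` is small for large `n` if `A` is uniformly small and
of bounded variation (`IntegralConv.eventually_small`). Applied to combinations of ramps at the
crossing times, this bounds the number of crossings, and also `sup |xₙ|`, uniformly in `n`. So the
approximating step functions are given by boundedly many jumps of bounded size, and compactness
with a diagonal argument gives a subsequence along which, for each `ε = 1/(j+1)`, the step functions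
converge weakly-* to a step function. The latter is within `ε` of `x₀`, because the integrals of
both against ramps, being limits along the subsequence, differ by at most `ε`
(`IntegralConv.exists_subseq_sConv`).
-/

open Set Filter Topology MeasureTheory
open scoped ENNReal

/-! ### Stieltjes integrals as integrals against a signed measure -/

instance {X : Type*} [MeasurableSpace X] (ρ : SignedMeasure X) :
    IsFiniteMeasure ρ.variation := by
  rw [← SignedMeasure.totalVariation_eq_variation]
  infer_instance

namespace SkorokhodSpace

variable {T : ℝ}

theorem start_le (hT : 0 < T) (t : Icc (0 : ℝ) T) : start hT ≤ t := t.2.1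

theorem le_final (hT : 0 < T) (t : Icc (0 : ℝ) T) : t ≤ final hT := t.2.2

theorem Iic_eq_Icc_start (hT : 0 < T) (t : Icc (0 : ℝ) T) : Iic t = Icc (start hT) t := by
  ext s; simp [start_le hT s]

theorem Iic_final (hT : 0 < T) : Iic (final hT) = univ := by
  ext s; simp [le_final hT s]

/-- Signed measures on `[0,T]` are determined by their distribution functions. -/
theorem signedMeasure_ext (hT : 0 < T) {ρ σ : SignedMeasure (Icc (0 : ℝ) T)}
    (h : ∀ t, ρ (Iic t) = σ (Iic t)) : ρ = σ := by
  refine VectorMeasure.ext_of_generateFrom (range Iic) ?_ ?_ isPiSystem_Iic ?_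
  · rintro _ ⟨t, rfl⟩
    exact h t
  · rw [← borel_eq_generateFrom_Iic]
    exact BorelSpace.measurable_eq
  · rw [← Iic_final hT]
    exact h _

/-- The signed measure `dv` on `[0,T]`, with the mass `v 0` at `0`. For right-continuous `v` its
distribution function is `v`. -/
noncomputable def stieltjesMeasure (hT : 0 < T) (v : Icc (0 : ℝ) T → ℝ)
    (hv : totalVariation hT v < ∞) : SignedMeasure (Icc (0 : ℝ) T) :=
  VectorMeasure.dirac (start hT) (v (start hT)) +
    (boundedVariationOn_of_totalVariation_lt_top hT hv).vectorMeasure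

theorem vectorMeasure_Iic (hT : 0 < T) {v : Icc (0 : ℝ) T → ℝ} (hv : BoundedVariationOn v univ)
    (hc : ∀ t, ContinuousWithinAt v (Ici t) t) (t : Icc (0 : ℝ) T) :
    hv.vectorMeasure (Iic t) = v t - v (start hT) := by
  rw [Iic_eq_Icc_start hT, hv.vectorMeasure_Icc (start_le hT t), (hc t).rightLim_eq,
    leftLim_eq_of_isBot (start_le hT)]

theorem stieltjesMeasure_Iic {hT : 0 < T} {v : Icc (0 : ℝ) T → ℝ} (hv : totalVariation hT v < ∞)
    (hc : ∀ t, ContinuousWithinAt v (Ici t) t) (t : Icc (0 : ℝ) T) :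
    stieltjesMeasure hT v hv (Iic t) = v t := by
  rw [stieltjesMeasure, add_apply, vectorMeasure_Iic hT _ hc,
    VectorMeasure.dirac_apply_of_mem measurableSet_Iic (mem_Iic.2 (start_le hT t))]
  ring

theorem stieltjesMeasure_univ {hT : 0 < T} {v : Icc (0 : ℝ) T → ℝ} (hv : totalVariation hT v < ∞)
    (hc : ∀ t, ContinuousWithinAt v (Ici t) t) :
    stieltjesMeasure hT v hv univ = v (final hT) := by
  rw [← Iic_final hT, stieltjesMeasure_Iic hv hc]

theorem eq_stieltjesMeasure {hT : 0 < T} {v : Icc (0 : ℝ) T → ℝ} (hv : totalVariation hT v < ∞)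
    (hc : ∀ t, ContinuousWithinAt v (Ici t) t) {ρ : SignedMeasure (Icc (0 : ℝ) T)}
    (h : ∀ t, ρ (Iic t) = v t) : stieltjesMeasure hT v hv = ρ :=
  signedMeasure_ext hT fun t => by rw [stieltjesMeasure_Iic hv hc, h]

theorem stieltjesIntegral_eq {hT : 0 < T} {f v : Icc (0 : ℝ) T → ℝ} (hv : totalVariation hT v < ∞)
    (hf : Measurable f) {C : ℝ} (hC : ∀ t, |f t| ≤ C) :
    stieltjesIntegral hT f v hv = ∫ᵛ t, f t ∂•(stieltjesMeasure hT v hv) := by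
  have hi : ∀ ρ : SignedMeasure (Icc (0 : ℝ) T), ρ.Integrable f := fun ρ =>
    Integrable.of_bound hf.aestronglyMeasurable C (Eventually.of_forall hC)
  rw [stieltjesMeasure, VectorMeasure.integral_add_vectorMeasure (hi _) (hi _),
    VectorMeasure.integral_dirac]
  rfl

theorem toSignedMeasure_stieltjesFunction_Iic (hT : 0 < T)
    (g : StieltjesFunction (Icc (0 : ℝ) T)) [IsFiniteMeasure g.measure] (t : Icc (0 : ℝ) T) :
    g.measure.toSignedMeasure (Iic t) = g t - g (start hT) := by
  rw [Measure.toSignedMeasure_apply_measurable measurableSet_Iic, Measure.real,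
    Iic_eq_Icc_start hT, g.measure_Icc, leftLim_eq_of_isBot (start_le hT),
    ENNReal.toReal_ofReal (sub_nonneg.2 (g.mono (start_le hT t)))]

theorem isFiniteMeasure_stieltjesFunction (hT : 0 < T) (g : StieltjesFunction (Icc (0 : ℝ) T)) :
    IsFiniteMeasure g.measure := by
  refine ⟨?_⟩
  rw [← Iic_final hT, Iic_eq_Icc_start hT, g.measure_Icc]
  exact ENNReal.ofReal_lt_top

/-- With `V` the variation function of `v`, the functions `V - v` and `V + v` are nondecreasing, so
that `dV - dv` and `dV + dv` are positive measures and `|dv| ≤ dV`. -/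
theorem variation_vectorMeasure_le (hT : 0 < T) {v : Icc (0 : ℝ) T → ℝ}
    (hv : BoundedVariationOn v univ) (hc : ∀ t, ContinuousWithinAt v (Ici t) t) :
    hv.vectorMeasure.variation univ ≤ eVariationOn v univ := by
  have hl := hv.locallyBoundedVariationOn
  set V := variationOnFromTo v univ (start hT) with hV
  have hVc : ∀ t, ContinuousWithinAt V (Ici t) t := fun t =>
    hv.continuousWithinAt_variationOnFromTo_Ici (hc t)
  let g : StieltjesFunction (Icc (0 : ℝ) T) :=
    ⟨V, monotoneOn_univ.1 (variationOnFromTo.monotoneOn hl (mem_univ _)), hVc⟩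
  let gs : StieltjesFunction (Icc (0 : ℝ) T) :=
    ⟨V - v, monotoneOn_univ.1 (variationOnFromTo.sub_self_monotoneOn hl (mem_univ _)),
      fun t => (hVc t).sub (hc t)⟩
  let ga : StieltjesFunction (Icc (0 : ℝ) T) :=
    ⟨V + v, monotoneOn_univ.1 (variationOnFromTo.add_self_monotoneOn hl (mem_univ _)),
      fun t => (hVc t).add (hc t)⟩
  have := isFiniteMeasure_stieltjesFunction hT g
  have := isFiniteMeasure_stieltjesFunction hT gs
  have := isFiniteMeasure_stieltjesFunction hT ga
  have hs : gs.measure.toSignedMeasure = g.measure.toSignedMeasure - hv.vectorMeasure := by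
    refine signedMeasure_ext hT fun t => ?_
    rw [sub_apply, vectorMeasure_Iic hT hv hc,
      toSignedMeasure_stieltjesFunction_Iic hT, toSignedMeasure_stieltjesFunction_Iic hT]
    change (V t - v t) - (V _ - v _) = (V t - V _) - _
    ring
  have ha : ga.measure.toSignedMeasure = g.measure.toSignedMeasure + hv.vectorMeasure := by
    refine signedMeasure_ext hT fun t => ?_
    rw [add_apply, vectorMeasure_Iic hT hv hc,
      toSignedMeasure_stieltjesFunction_Iic hT, toSignedMeasure_stieltjesFunction_Iic hT]
    change (V t + v t) - (V _ + v _) = (V t - V _) + _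
    ring
  have hle : hv.vectorMeasure.variation ≤ g.measure := by
    refine VectorMeasure.variation_le_of_forall_enorm_le fun E hE => ?_
    have h1 := congrArg (fun ρ => ρ E) hs
    have h2 := congrArg (fun ρ => ρ E) ha
    simp only [sub_apply, add_apply,
      Measure.toSignedMeasure_apply_measurable hE] at h1 h2
    rw [Real.enorm_eq_ofReal_abs]
    refine ENNReal.ofReal_le_of_le_toReal (abs_le.2 ⟨?_, ?_⟩)
    · have : 0 ≤ ga.measure.real E := measureReal_nonneg
      change -(g.measure.real E) ≤ _
      linarith
    · have : 0 ≤ gs.measure.real E := measureReal_nonneg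
      change _ ≤ g.measure.real E
      linarith
  refine (hle univ).trans ?_
  rw [← Iic_final hT, Iic_eq_Icc_start hT, g.measure_Icc, leftLim_eq_of_isBot (start_le hT)]
  change ENNReal.ofReal (V _ - V _) ≤ _
  rw [hV, variationOnFromTo.self, sub_zero, variationOnFromTo.eq_of_le _ _ (start_le hT _)]
  rw [← Iic_eq_Icc_start, Iic_final, univ_inter]
  exact ENNReal.ofReal_toReal_le

theorem variation_stieltjesMeasure_le {hT : 0 < T} {v : Icc (0 : ℝ) T → ℝ}
    (hv : totalVariation hT v < ∞) (hc : ∀ t, ContinuousWithinAt v (Ici t) t) :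
    (stieltjesMeasure hT v hv).variation univ ≤ totalVariation hT v := by
  refine (VectorMeasure.variation_add_le univ).trans ?_
  rw [totalVariation, Measure.add_apply]
  refine add_le_add ?_ (variation_vectorMeasure_le hT _ hc)
  simp

/-- The basic estimate `|∫ f dv| ≤ sup |f| · ‖v‖(T)`. -/
theorem abs_stieltjesIntegral_le {hT : 0 < T} {f v : Icc (0 : ℝ) T → ℝ}
    (hv : totalVariation hT v < ∞) (hc : ∀ t, ContinuousWithinAt v (Ici t) t)
    (hf : Measurable f) {C : ℝ} (hC : ∀ t, |f t| ≤ C) :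
    |stieltjesIntegral hT f v hv| ≤ C * (totalVariation hT v).toReal := by
  rw [stieltjesIntegral_eq hv hf hC]
  have h0 : 0 ≤ C := (abs_nonneg _).trans (hC (start hT))
  have h := VectorMeasure.norm_integral_le_of_norm_le_const (μ := stieltjesMeasure hT v hv)
    (B := ContinuousLinearMap.lsmul ℝ ℝ) (f := f) (C := C) (Eventually.of_forall hC)
  rw [Real.norm_eq_abs] at h
  refine h.trans ?_
  have h2 : (stieltjesMeasure hT v hv).variation.real univ ≤ (totalVariation hT v).toReal :=
    ENNReal.toReal_mono hv.ne (variation_stieltjesMeasure_le hv hc)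
  have h3 : ‖(ContinuousLinearMap.lsmul ℝ ℝ : ℝ →L[ℝ] ℝ →L[ℝ] ℝ)‖ ≤ 1 :=
    ContinuousLinearMap.opNorm_lsmul_le
  calc _ ≤ C * 1 * (totalVariation hT v).toReal := by gcongr
    _ = _ := by ring

theorem stieltjesIntegral_sub {hT : 0 < T} {f g v : Icc (0 : ℝ) T → ℝ}
    (hv : totalVariation hT v < ∞) (hf : Measurable f) {C : ℝ} (hC : ∀ t, |f t| ≤ C)
    (hg : Measurable g) {D : ℝ} (hD : ∀ t, |g t| ≤ D) :
    stieltjesIntegral hT (fun t => f t - g t) v hv =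
      stieltjesIntegral hT f v hv - stieltjesIntegral hT g v hv := by
  rw [stieltjesIntegral, stieltjesIntegral, stieltjesIntegral, VectorMeasure.integral_fun_sub]
  · ring
  · exact Integrable.of_bound hf.aestronglyMeasurable C (Eventually.of_forall hC)
  · exact Integrable.of_bound hg.aestronglyMeasurable D (Eventually.of_forall hD)

/-- Integrals of uniformly close functions are close. -/
theorem abs_stieltjesIntegral_sub_le {hT : 0 < T} {f g v : Icc (0 : ℝ) T → ℝ}
    (hv : totalVariation hT v < ∞) (hc : ∀ t, ContinuousWithinAt v (Ici t) t)
    (hf : Measurable f) {C : ℝ} (hC : ∀ t, |f t| ≤ C)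
    (hg : Measurable g) {D : ℝ} (hD : ∀ t, |g t| ≤ D) {ε : ℝ} (h : ∀ t, |f t - g t| ≤ ε) :
    |stieltjesIntegral hT f v hv - stieltjesIntegral hT g v hv| ≤
      ε * (totalVariation hT v).toReal := by
  rw [← stieltjesIntegral_sub hv hf hC hg hD]
  exact abs_stieltjesIntegral_le hv hc (hf.sub hg) h

/-- Fubini's theorem for signed measures on the set `{(s, t) | t ≤ s}`. -/
theorem integral_Iic_eq_integral_Ici (ρ σ : SignedMeasure (Icc (0 : ℝ) T)) :
    ∫ᵛ s, σ (Iic s) ∂•ρ = ∫ᵛ t, ρ (Ici t) ∂•σ := by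
  have hΔ : MeasurableSet {p : Icc (0 : ℝ) T × Icc (0 : ℝ) T | p.2 ≤ p.1} :=
    measurableSet_le measurable_snd measurable_fst
  have h1 := VectorMeasure.prod_flip_apply_eq_integral (μ := ρ) (ν := σ)
    (B := ContinuousLinearMap.lsmul ℝ ℝ) hΔ
  have hΔ' : MeasurableSet {p : Icc (0 : ℝ) T × Icc (0 : ℝ) T | p.1 ≤ p.2} :=
    measurableSet_le measurable_fst measurable_snd
  have h2 := VectorMeasure.prod_flip_apply_eq_integral (μ := σ) (ν := ρ)
    (B := ContinuousLinearMap.lsmul ℝ ℝ) hΔ'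
  have e1 : ∀ s : Icc (0 : ℝ) T, Prod.mk s ⁻¹' {p : Icc (0 : ℝ) T × Icc (0 : ℝ) T | p.2 ≤ p.1} =
    Iic s := fun s => rfl
  have e2 : ∀ s : Icc (0 : ℝ) T, Prod.mk s ⁻¹' {p : Icc (0 : ℝ) T × Icc (0 : ℝ) T | p.1 ≤ p.2} =
    Ici s := fun s => rfl
  simp only [e1] at h1
  simp only [e2] at h2
  rw [← h1, ← h2]
  have h3 : ρ.prod σ (ContinuousLinearMap.lsmul ℝ ℝ).flip =
      (σ.prod ρ (ContinuousLinearMap.lsmul ℝ ℝ).flip).map Prod.swap := by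
    refine VectorMeasure.prod_eq_of_forall_apply_prod fun s t hs ht => ?_
    rw [VectorMeasure.map_apply _ measurable_swap (hs.prod ht), preimage_swap_prod,
      VectorMeasure.prod_apply]
    simp [mul_comm]
  rw [h3, VectorMeasure.map_apply _ measurable_swap hΔ]
  rfl

theorem measurable_of_boundedVariationOn {v : Icc (0 : ℝ) T → ℝ}
    (hv : BoundedVariationOn v univ) : Measurable v := by
  obtain ⟨p, q, hp, hq, rfl⟩ :=
    hv.locallyBoundedVariationOn.exists_monotoneOn_sub_monotoneOn
  exact (monotoneOn_univ.1 hp).measurable.sub (monotoneOn_univ.1 hq).measurable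

theorem abs_le_totalVariation {hT : 0 < T} {v : Icc (0 : ℝ) T → ℝ} (hv : totalVariation hT v < ∞)
    (t : Icc (0 : ℝ) T) : |v t| ≤ (totalVariation hT v).toReal := by
  rw [← ENNReal.ofReal_le_iff_le_toReal hv.ne, ← Real.enorm_eq_ofReal_abs]
  calc ‖v t‖ₑ = ‖v (start hT) + (v t - v (start hT))‖ₑ := by congr 1; ring
    _ ≤ ‖v (start hT)‖ₑ + ‖v t - v (start hT)‖ₑ := enorm_add_le _ _
    _ ≤ _ := by
      rw [totalVariation, ← edist_eq_enorm_sub]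
      gcongr
      exact eVariationOn.edist_le v (mem_univ _) (mem_univ _)

/-- Integration by parts against a continuous function vanishing at `0`. -/
theorem stieltjesIntegral_by_parts {hT : 0 < T} {v A : Icc (0 : ℝ) T → ℝ}
    (hv : totalVariation hT v < ∞) (hvc : ∀ t, ContinuousWithinAt v (Ici t) t)
    (hA : totalVariation hT A < ∞) (hAc : Continuous A) (hA0 : A (start hT) = 0) :
    stieltjesIntegral hT v A hA =
      v (final hT) * A (final hT) - stieltjesIntegral hT A v hv := by
  have hAr : ∀ t, ContinuousWithinAt A (Ici t) t := fun t => hAc.continuousWithinAt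
  have hvm : Measurable v := measurable_of_boundedVariationOn
    (boundedVariationOn_of_totalVariation_lt_top hT hv)
  rw [stieltjesIntegral_eq hA hvm (abs_le_totalVariation hv),
    stieltjesIntegral_eq hv hAc.measurable (abs_le_totalVariation hA)]
  have h := integral_Iic_eq_integral_Ici (stieltjesMeasure hT A hA) (stieltjesMeasure hT v hv)
  simp only [stieltjesMeasure_Iic hv hvc] at h
  rw [h]
  -- by continuity of `A`, the half-line `[t, T]` has the mass `A T - A t`
  have hIci : ∀ t, stieltjesMeasure hT A hA (Ici t) = A (final hT) - A t := by
    intro t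
    have e : Ici t = Icc t (final hT) := by ext s; simp [le_final hT s]
    have hl : A.leftLim t = A t := by
      by_cases hb : 𝓝[<] t = ⊥
      · exact leftLim_eq_of_eq_bot _ hb
      · have : (𝓝[<] t).NeBot := ⟨hb⟩
        exact leftLim_eq_of_tendsto hAc.continuousWithinAt
    rw [stieltjesMeasure, hA0, VectorMeasure.dirac_zero, zero_add, e,
      BoundedVariationOn.vectorMeasure_Icc _ (le_final hT t), (hAr _).rightLim_eq, hl]
  simp only [hIci]
  rw [VectorMeasure.integral_fun_sub, VectorMeasure.integral_const,
    stieltjesMeasure_univ hv hvc]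
  · simp [mul_comm]
  · exact integrable_const _
  · exact Integrable.of_bound hAc.measurable.aestronglyMeasurable _
      (Eventually.of_forall (abs_le_totalVariation hA))

theorem totalVariation_sum_le (hT : 0 < T) {ι : Type*} (s : Finset ι) (c : ι → ℝ)
    (g : ι → Icc (0 : ℝ) T → ℝ) :
    totalVariation hT (fun t => ∑ k ∈ s, c k * g k t) ≤
      ∑ k ∈ s, ‖c k‖ₑ * totalVariation hT (g k) := by
  simp only [totalVariation, mul_add, Finset.sum_add_distrib]
  refine add_le_add ?_ ?_
  · refine (enorm_sum_le _ _).trans (le_of_eq ?_)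
    simp [enorm_mul]
  · refine iSup_le fun p => ?_
    calc _ ≤ ∑ i ∈ Finset.range p.1, ∑ k ∈ s,
          ‖c k‖ₑ * edist (g k (p.2.1 (i + 1))) (g k (p.2.1 i)) := by
          refine Finset.sum_le_sum fun i _ => ?_
          rw [edist_eq_enorm_sub, ← Finset.sum_sub_distrib]
          refine (enorm_sum_le _ _).trans (le_of_eq ?_)
          refine Finset.sum_congr rfl fun k _ => ?_
          rw [← mul_sub, enorm_mul, edist_eq_enorm_sub]
      _ = ∑ k ∈ s, ‖c k‖ₑ * ∑ i ∈ Finset.range p.1,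
          edist (g k (p.2.1 (i + 1))) (g k (p.2.1 i)) := by
          rw [Finset.sum_comm]
          simp only [Finset.mul_sum]
      _ ≤ _ := by
          gcongr with k _
          exact eVariationOn.sum_le p.2.2.1 p.2.2.2

theorem totalVariation_sum_lt_top {hT : 0 < T} {ι : Type*} (s : Finset ι) (c : ι → ℝ)
    {g : ι → Icc (0 : ℝ) T → ℝ} (hg : ∀ k, totalVariation hT (g k) < ∞) :
    totalVariation hT (fun t => ∑ k ∈ s, c k * g k t) < ∞ :=
  (totalVariation_sum_le hT s c g).trans_lt
    (ENNReal.sum_lt_top.2 fun k _ => ENNReal.mul_lt_top (by simp) (hg k))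

theorem totalVariation_of_monotone (hT : 0 < T) {g : Icc (0 : ℝ) T → ℝ} (hg : Monotone g)
    (h0 : 0 ≤ g (start hT)) : totalVariation hT g = ENNReal.ofReal (g (final hT)) := by
  have h := (hg.monotoneOn univ).eVariationOn_eq (mem_univ (start hT)) (mem_univ (final hT))
  rw [univ_inter, ← Iic_eq_Icc_start, Iic_final] at h
  rw [totalVariation, h, Real.enorm_eq_ofReal h0,
    ← ENNReal.ofReal_add h0 (sub_nonneg.2 (hg (start_le hT _)))]
  ring_nf

theorem rightContinuous_sum {ι : Type*} (s : Finset ι) (c : ι → ℝ)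
    {g : ι → Icc (0 : ℝ) T → ℝ} (hg : ∀ k t, ContinuousWithinAt (g k) (Ici t) t)
    (t : Icc (0 : ℝ) T) : ContinuousWithinAt (fun t => ∑ k ∈ s, c k * g k t) (Ici t) t :=
  tendsto_finsetSum s fun k _ => (hg k t).const_mul (c k)

theorem stieltjesIntegral_sum {hT : 0 < T} {ι : Type*} (s : Finset ι) (c : ι → ℝ)
    {g : ι → Icc (0 : ℝ) T → ℝ} (hg : ∀ k, totalVariation hT (g k) < ∞)
    (hgc : ∀ k t, ContinuousWithinAt (g k) (Ici t) t) {f : Icc (0 : ℝ) T → ℝ}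
    (hf : Measurable f) {C : ℝ} (hC : ∀ t, |f t| ≤ C) :
    stieltjesIntegral hT f (fun t => ∑ k ∈ s, c k * g k t) (totalVariation_sum_lt_top s c hg) =
      ∑ k ∈ s, c k * stieltjesIntegral hT f (g k) (hg k) := by
  have hi : ∀ ρ : SignedMeasure (Icc (0 : ℝ) T), ρ.Integrable f := fun ρ =>
    Integrable.of_bound hf.aestronglyMeasurable C (Eventually.of_forall hC)
  have hρ : stieltjesMeasure hT _ (totalVariation_sum_lt_top s c hg) =
      ∑ k ∈ s, c k • stieltjesMeasure hT (g k) (hg k) := by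
    refine eq_stieltjesMeasure _ (rightContinuous_sum s c hgc) fun t => ?_
    rw [FunLike.coe_sum, Finset.sum_apply]
    simp [stieltjesMeasure_Iic (hg _) (hgc _)]
  rw [stieltjesIntegral_eq _ hf hC, hρ,
    VectorMeasure.integral_finsetSum_vectorMeasure fun k _ => hi _]
  refine Finset.sum_congr rfl fun k _ => ?_
  rw [stieltjesIntegral_eq _ hf hC, VectorMeasure.integral_smul_vectorMeasure, smul_eq_mul]

end SkorokhodSpace

/-! ### Step functions -/

namespace SkorokhodSpace

variable {T : ℝ}

/-- The unit jump at `τ`: the indicator function of `[τ, T]`. -/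
noncomputable def unitJump (τ t : Icc (0 : ℝ) T) : ℝ := if τ ≤ t then 1 else 0

theorem unitJump_monotone (τ : Icc (0 : ℝ) T) : Monotone (unitJump τ) := by
  intro s t hst
  unfold unitJump
  split_ifs with h1 h2
  · exact le_rfl
  · exact absurd (h1.trans hst) h2
  · exact zero_le_one
  · exact le_rfl

theorem totalVariation_unitJump (hT : 0 < T) (τ : Icc (0 : ℝ) T) :
    totalVariation hT (unitJump τ) < ∞ := by
  rw [totalVariation_of_monotone hT (unitJump_monotone τ)]
  · exact ENNReal.ofReal_lt_top
  · unfold unitJump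
    split_ifs <;> norm_num

theorem unitJump_rightContinuous (τ t : Icc (0 : ℝ) T) :
    ContinuousWithinAt (unitJump τ) (Ici t) t := by
  by_cases h : τ ≤ t
  · refine (continuousWithinAt_const (b := (1 : ℝ))).congr (fun s hs => ?_) ?_
    · exact if_pos (h.trans hs)
    · exact if_pos h
  · have h' : t < τ := not_le.1 h
    refine ((continuousAt_const (y := (0 : ℝ))).congr ?_).continuousWithinAt
    filter_upwards [Iio_mem_nhds h'] with s hs
    exact (if_neg (not_le.2 hs)).symm

theorem stieltjesIntegral_unitJump (hT : 0 < T) (τ : Icc (0 : ℝ) T) {f : Icc (0 : ℝ) T → ℝ}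
    (hf : Measurable f) {C : ℝ} (hC : ∀ t, |f t| ≤ C) :
    stieltjesIntegral hT f (unitJump τ) (totalVariation_unitJump hT τ) = f τ := by
  have hρ : stieltjesMeasure hT _ (totalVariation_unitJump hT τ) = VectorMeasure.dirac τ 1 := by
    refine eq_stieltjesMeasure _ (unitJump_rightContinuous τ) fun t => ?_
    by_cases h : τ ≤ t
    · rw [VectorMeasure.dirac_apply_of_mem measurableSet_Iic (mem_Iic.2 h), unitJump, if_pos h]
    · rw [VectorMeasure.dirac_apply_of_notMem (by simpa using h), unitJump, if_neg h]
  rw [stieltjesIntegral_eq _ hf hC, hρ, VectorMeasure.integral_dirac]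
  simp

/-- A right-continuous function of finite variation as an element of `𝕍`; its left limits exist
automatically. -/
noncomputable def FiniteVariation.ofRightContinuous {hT : 0 < T} (v : Icc (0 : ℝ) T → ℝ)
    (hv : totalVariation hT v < ∞) (hc : ∀ t, ContinuousWithinAt v (Ici t) t) :
    FiniteVariation hT where
  toFun := v
  right_continuous := hc
  left_limits t :=
    ⟨_, (boundedVariationOn_of_totalVariation_lt_top hT hv).tendsto_leftLim t⟩
  finite_variation := hv

/-- The step function with the jumps `(p k).2` at the times `(p k).1`, `k < K`. The times need
neither be distinct nor ordered. -/
noncomputable def stepFV (hT : 0 < T) (K : ℕ) (p : ℕ → Icc (0 : ℝ) T × ℝ) : FiniteVariation hT :=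
  .ofRightContinuous (fun t => ∑ k ∈ Finset.range K, (p k).2 * unitJump (p k).1 t)
    (totalVariation_sum_lt_top _ _ fun k => totalVariation_unitJump hT (p k).1)
    (rightContinuous_sum _ _ fun k => unitJump_rightContinuous (p k).1)

theorem stepFV_apply (hT : 0 < T) (K : ℕ) (p : ℕ → Icc (0 : ℝ) T × ℝ) (t : Icc (0 : ℝ) T) :
    (stepFV hT K p).toFun t = ∑ k ∈ Finset.range K, (p k).2 * unitJump (p k).1 t := rfl

theorem stieltjesIntegral_stepFV (hT : 0 < T) (K : ℕ) (p : ℕ → Icc (0 : ℝ) T × ℝ)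
    {f : Icc (0 : ℝ) T → ℝ} (hf : Measurable f) {C : ℝ} (hC : ∀ t, |f t| ≤ C) :
    stieltjesIntegral hT f (stepFV hT K p).toFun (stepFV hT K p).finite_variation =
      ∑ k ∈ Finset.range K, (p k).2 * f (p k).1 := by
  refine (stieltjesIntegral_sum (Finset.range K) (fun k => (p k).2)
    (fun k => totalVariation_unitJump hT (p k).1)
    (fun k => unitJump_rightContinuous (p k).1) hf hC).trans ?_
  exact Finset.sum_congr rfl fun k _ => by rw [stieltjesIntegral_unitJump hT _ hf hC]

/-! ### Approximation of càdlàg functions by step functions -/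

theorem exists_next_crossing (hT : 0 < T) (x : SkorokhodSpace T) {ε : ℝ} (hε : 0 < ε)
    (t : Icc (0 : ℝ) T) :
    ∃ s, t ≤ s ∧ (t < final hT → t < s) ∧ (∀ u, t ≤ u → u < s → |x u - x t| ≤ ε) ∧
      (s < final hT → ε ≤ |x s - x t|) := by
  set S : Set (Icc (0 : ℝ) T) := {u | t ≤ u ∧ ε < |x u - x t|} with hS
  rcases S.eq_empty_or_nonempty with h | h
  · refine ⟨final hT, le_final hT t, id, fun u hu _ => ?_, fun h => absurd h (lt_irrefl _)⟩
    by_contra hcon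
    exact (h ▸ (⟨hu, not_le.1 hcon⟩ : u ∈ S) : u ∈ (∅ : Set _))
  · obtain ⟨s, hs⟩ : ∃ s, IsLeast (closure S) s :=
      isClosed_closure.isCompact.exists_isLeast h.closure
    have hglb : IsGLB S s := isGLB_of_mem_closure (lowerBounds_mono_set subset_closure hs.2) hs.1
    have hts : t ≤ s := hglb.2 fun u hu => hu.1
    have hlow : ∀ u, t ≤ u → u < s → |x u - x t| ≤ ε := by
      intro u hu hus
      by_contra hcon
      exact absurd (hglb.1 (⟨hu, not_le.1 hcon⟩ : u ∈ S)) (not_le.2 hus)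
    have hfreq : ∃ᶠ u in 𝓝[≥] s, u ∈ S := hglb.frequently_mem h
    have hlim : Tendsto (fun u => |x u - x t|) (𝓝[≥] s) (𝓝 |x s - x t|) :=
      ((x.right_continuous s).tendsto.sub_const _).abs
    have hge : ε ≤ |x s - x t| := by
      by_contra hcon
      have := hlim.eventually_lt_const (not_le.1 hcon)
      obtain ⟨u, hu1, hu2⟩ := (hfreq.and_eventually this).exists
      exact absurd hu1.2 (not_lt.2 hu2.le)
    refine ⟨s, hts, fun _ => ?_, hlow, fun _ => hge⟩
    refine lt_of_le_of_ne hts ?_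
    rintro rfl
    rw [sub_self, abs_zero] at hge
    exact absurd hge (not_le.2 hε)

/-- A time after `t`, if `t < T`, until which `x` stays within `ε` of `x t`, and at which, unless it is
`T`, `x` has moved by at least `ε` away from `x t`. -/
noncomputable def nextCrossing (hT : 0 < T) (x : SkorokhodSpace T) {ε : ℝ} (hε : 0 < ε)
    (t : Icc (0 : ℝ) T) : Icc (0 : ℝ) T :=
  (exists_next_crossing hT x hε t).choose

/-- The successive times, from `0` on, at which `x` has moved by at least `ε`; the sequence
remains at `T` once there are no such times left. -/
noncomputable def crossing (hT : 0 < T) (x : SkorokhodSpace T) {ε : ℝ} (hε : 0 < ε) (k : ℕ) :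
    Icc (0 : ℝ) T :=
  (nextCrossing hT x hε)^[k] (start hT)

section Crossing

variable (hT : 0 < T) (x : SkorokhodSpace T) {ε : ℝ} (hε : 0 < ε)

theorem crossing_zero : crossing hT x hε 0 = start hT := rfl

theorem crossing_succ_spec (k : ℕ) :
    crossing hT x hε k ≤ crossing hT x hε (k + 1) ∧
    (crossing hT x hε k < final hT → crossing hT x hε k < crossing hT x hε (k + 1)) ∧
    (∀ u, crossing hT x hε k ≤ u → u < crossing hT x hε (k + 1) →
      |x u - x (crossing hT x hε k)| ≤ ε) ∧
    (crossing hT x hε (k + 1) < final hT →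
      ε ≤ |x (crossing hT x hε (k + 1)) - x (crossing hT x hε k)|) := by
  have e : crossing hT x hε (k + 1) = nextCrossing hT x hε (crossing hT x hε k) :=
    Function.iterate_succ_apply' _ _ _
  rw [e]
  exact (exists_next_crossing hT x hε (crossing hT x hε k)).choose_spec

theorem crossing_monotone : Monotone (crossing hT x hε) :=
  monotone_nat_of_le_succ fun k => (crossing_succ_spec hT x hε k).1

/-- A càdlàg function crosses finitely often: at an accumulation point of the crossing times it
would have no left limit. -/
theorem exists_crossing_eq_final : ∃ K, crossing hT x hε K = final hT := by
  by_contra! hne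
  have hlt : ∀ k, crossing hT x hε k < final hT := fun k => (le_final hT _).lt_of_ne (hne k)
  have hmono : StrictMono (crossing hT x hε) :=
    strictMono_nat_of_lt_succ fun k => (crossing_succ_spec hT x hε k).2.1 (hlt k)
  obtain ⟨τ, hτ⟩ : ∃ τ, Tendsto (crossing hT x hε) atTop (𝓝 τ) := by
    obtain ⟨τ, hτ⟩ : ∃ τ, IsGreatest (closure (range (crossing hT x hε))) τ :=
      isClosed_closure.isCompact.exists_isGreatest (range_nonempty _).closure
    exact ⟨τ, tendsto_atTop_isLUB hmono.monotone
      (isLUB_of_mem_closure (upperBounds_mono_set subset_closure hτ.2) hτ.1)⟩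
  have hτlt : ∀ k, crossing hT x hε k < τ := fun k =>
    (hmono k.lt_succ_self).trans_le (hmono.monotone.ge_of_tendsto hτ _)
  obtain ⟨l, hl⟩ := x.left_limits τ
  have h1 : Tendsto (fun k => x (crossing hT x hε k)) atTop (𝓝 l) :=
    hl.comp (tendsto_nhdsWithin_iff.2 ⟨hτ, Eventually.of_forall hτlt⟩)
  have h2 := ((h1.comp (tendsto_add_atTop_nat 1)).sub h1).abs
  rw [sub_self, abs_zero] at h2
  obtain ⟨k, hk⟩ := (h2.eventually_lt_const hε).exists
  exact absurd hk (not_lt.2 ((crossing_succ_spec hT x hε k).2.2.2 (hlt _)))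

/-- The crossing times of `x`, with the increments of `x` between them; at time `0` the increment
is `x 0`. -/
noncomputable def crossingJumps (k : ℕ) : Icc (0 : ℝ) T × ℝ :=
  (crossing hT x hε k,
    if k = 0 then x (start hT) else x (crossing hT x hε k) - x (crossing hT x hε (k - 1)))

theorem sum_crossingJumps (j : ℕ) :
    ∑ k ∈ Finset.range (j + 1), (crossingJumps hT x hε k).2 = x (crossing hT x hε j) := by
  induction j with
  | zero => simp [crossingJumps, crossing_zero]
  | succ j ih =>
    rw [Finset.sum_range_succ, ih]
    simp [crossingJumps]

theorem abs_sub_stepFV_crossingJumps_le {K : ℕ} (hK : crossing hT x hε K = final hT)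
    (t : Icc (0 : ℝ) T) :
    |x t - (stepFV hT (K + 1) (crossingJumps hT x hε)).toFun t| ≤ ε := by
  have hstep : ∀ j ≤ K, crossing hT x hε j ≤ t → (j < K → t < crossing hT x hε (j + 1)) →
      (stepFV hT (K + 1) (crossingJumps hT x hε)).toFun t = x (crossing hT x hε j) := by
    intro j hj h1 h2
    rw [stepFV_apply, ← sum_crossingJumps,
      ← Finset.sum_subset (Finset.range_mono (Nat.succ_le_succ hj))]
    · refine Finset.sum_congr rfl fun k hk => ?_
      have : crossing hT x hε k ≤ t :=
        (crossing_monotone hT x hε (Nat.lt_succ_iff.1 (Finset.mem_range.1 hk))).trans h1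
      simp [unitJump, crossingJumps, this]
    · intro k hk hk'
      rw [Finset.mem_range] at hk hk'
      have : t < crossing hT x hε k :=
        (h2 (by omega)).trans_le (crossing_monotone hT x hε (by omega))
      simp [unitJump, crossingJumps, this.not_ge]
  rcases (le_final hT t).eq_or_lt with h | h
  · rw [hstep K le_rfl (hK.trans h.symm).le fun h => absurd h (lt_irrefl _), hK, h, sub_self,
      abs_zero]
    exact hε.le
  · -- the first crossing time after `t`
    have hex : ∃ k, t < crossing hT x hε k := ⟨K, hK ▸ h⟩
    classical
    obtain ⟨j, hj⟩ : ∃ j, Nat.find hex = j + 1 := by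
      refine Nat.exists_eq_succ_of_ne_zero fun h0 => ?_
      have := Nat.find_spec hex
      rw [h0, crossing_zero] at this
      exact absurd (start_le hT t) (not_le.2 this)
    have h1 : crossing hT x hε j ≤ t := not_lt.1 (Nat.find_min hex (by omega))
    have h2 : t < crossing hT x hε (j + 1) := hj ▸ Nat.find_spec hex
    have hjK : j ≤ K := by
      have := Nat.find_min' hex (hK ▸ h : t < crossing hT x hε K)
      omega
    rw [hstep j hjK h1 fun _ => h2]
    exact (crossing_succ_spec hT x hε j).2.2.1 t h1 h2

end Crossing

theorem exists_stepFV_near (hT : 0 < T) (x : SkorokhodSpace T) {ε : ℝ} (hε : 0 < ε) :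
    ∃ K p, ∀ t, |x t - (stepFV hT K p).toFun t| ≤ ε := by
  obtain ⟨K, hK⟩ := exists_crossing_eq_final hT x hε
  exact ⟨K + 1, crossingJumps hT x hε, abs_sub_stepFV_crossingJumps_le hT x hε hK⟩

theorem FiniteVariation.measurable {hT : 0 < T} (v : FiniteVariation hT) : Measurable v.toFun :=
  measurable_of_boundedVariationOn
    (boundedVariationOn_of_totalVariation_lt_top hT v.finite_variation)

theorem measurable (hT : 0 < T) (x : SkorokhodSpace T) : Measurable x.toFun := by
  choose K p h using fun n : ℕ => exists_stepFV_near hT x (Nat.one_div_pos_of_nat (α := ℝ) (n := n))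
  refine measurable_of_tendsto_metrizable
    (fun n => (stepFV hT (K n) (p n)).measurable) (tendsto_pi_nhds.2 fun t => ?_)
  rw [tendsto_iff_dist_tendsto_zero]
  refine squeeze_zero (fun _ => dist_nonneg) (fun n => ?_) tendsto_one_div_add_atTop_nhds_zero_nat
  rw [dist_comm, Real.dist_eq]
  exact h n t

theorem exists_bound (hT : 0 < T) (x : SkorokhodSpace T) : ∃ C, ∀ t, |x t| ≤ C := by
  obtain ⟨K, p, h⟩ := exists_stepFV_near hT x one_pos
  refine ⟨1 + (totalVariation hT (stepFV hT K p).toFun).toReal, fun t => ?_⟩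
  have h1 := abs_le_totalVariation (stepFV hT K p).finite_variation t
  have h2 := abs_sub_abs_le_abs_sub (x t) ((stepFV hT K p).toFun t)
  linarith [h t]

end SkorokhodSpace

/-! ### Integrals against continuous functions of finite variation -/

theorem tendsto_of_forall_approx {a : ℕ → ℝ} {a₀ : ℝ}
    (h : ∀ ε : ℝ, 0 < ε → ∃ (b : ℕ → ℝ) (b₀ : ℝ), Tendsto b atTop (𝓝 b₀) ∧
      (∀ n, |a n - b n| ≤ ε) ∧ |a₀ - b₀| ≤ ε) :
    Tendsto a atTop (𝓝 a₀) := by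
  rw [Metric.tendsto_atTop']
  intro ε hε
  obtain ⟨b, b₀, hb, h1, h2⟩ := h (ε / 4) (by positivity)
  obtain ⟨N, hN⟩ := Metric.tendsto_atTop'.1 hb (ε / 4) (by positivity)
  refine ⟨N, fun n hn => ?_⟩
  have h3 := hN n hn
  rw [Real.dist_eq] at h3 ⊢
  have := h1 n
  rw [abs_lt] at *
  rw [abs_le] at *
  constructor <;> linarith [this.1, this.2, h2.1, h2.2, h3.1, h3.2]

namespace SkorokhodSpace

variable {T : ℝ}

theorem ContinuousFV.rightContinuous {hT : 0 < T} (A : ContinuousFV hT) (t : Icc (0 : ℝ) T) :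
    ContinuousWithinAt A.toFun (Ici t) t :=
  A.continuous_toFun.continuousWithinAt

/-- Finite linear combinations in `𝔸`. -/
noncomputable def ContinuousFV.sum {hT : 0 < T} {ι : Type*} (s : Finset ι) (c : ι → ℝ)
    (A : ι → ContinuousFV hT) : ContinuousFV hT where
  toFun t := ∑ k ∈ s, c k * (A k).toFun t
  continuous_toFun := continuous_finsetSum s fun k _ => (A k).continuous_toFun.const_mul (c k)
  finite_variation := totalVariation_sum_lt_top s c fun k => (A k).finite_variation
  map_start := by simp [(A _).map_start]

theorem integralAgainst_sum {hT : 0 < T} {ι : Type*} (s : Finset ι) (c : ι → ℝ)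
    (A : ι → ContinuousFV hT) (x : SkorokhodSpace T) :
    integralAgainst x (ContinuousFV.sum s c A) = ∑ k ∈ s, c k * integralAgainst x (A k) := by
  obtain ⟨C, hC⟩ := x.exists_bound hT
  exact stieltjesIntegral_sum s c (fun k => (A k).finite_variation)
    (fun k => (A k).rightContinuous) (x.measurable hT) hC

theorem abs_integralAgainst_sub_le {hT : 0 < T} (x y : SkorokhodSpace T) (A : ContinuousFV hT)
    {ε : ℝ} (h : ∀ t, |x t - y t| ≤ ε) :
    |integralAgainst x A - integralAgainst y A| ≤ ε * (totalVariation hT A.toFun).toReal := by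
  obtain ⟨C, hC⟩ := x.exists_bound hT
  obtain ⟨D, hD⟩ := y.exists_bound hT
  exact abs_stieltjesIntegral_sub_le A.finite_variation A.rightContinuous (x.measurable hT) hC
    (y.measurable hT) hD h

theorem FiniteVariation.integralAgainst_eq {hT : 0 < T} (v : FiniteVariation hT)
    (A : ContinuousFV hT) :
    integralAgainst v.toSkorokhodSpace A = v.toFun (final hT) * A.toFun (final hT) -
      stieltjesIntegral hT A.toFun v.toFun v.finite_variation :=
  stieltjesIntegral_by_parts v.finite_variation v.right_continuous A.finite_variation
    A.continuous_toFun A.map_start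

/-- The function that is `0` up to time `t` and then increases with slope `m` until it reaches
the value `1`. For `m → ∞`, integration against it becomes evaluation at `t`. -/
noncomputable def ramp (hT : 0 < T) (t : Icc (0 : ℝ) T) (m : ℕ) : ContinuousFV hT where
  toFun s := min 1 (max 0 (m * ((s : ℝ) - t)))
  continuous_toFun := by fun_prop
  finite_variation := by
    rw [totalVariation_of_monotone hT]
    · exact ENNReal.ofReal_lt_top
    · intro s u hsu
      have : (s : ℝ) ≤ u := hsu
      dsimp only
      gcongr
    · positivity
  map_start := by
    have h : (m : ℝ) * ((start hT : ℝ) - t) ≤ 0 :=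
      mul_nonpos_of_nonneg_of_nonpos m.cast_nonneg (sub_nonpos.2 (start_le hT t))
    rw [max_eq_left h]
    norm_num

theorem ramp_apply (hT : 0 < T) (t : Icc (0 : ℝ) T) (m : ℕ) (s : Icc (0 : ℝ) T) :
    (ramp hT t m).toFun s = min 1 (max 0 (m * ((s : ℝ) - t))) := rfl

theorem ramp_nonneg (hT : 0 < T) (t : Icc (0 : ℝ) T) (m : ℕ) (s : Icc (0 : ℝ) T) :
    0 ≤ (ramp hT t m).toFun s := by
  rw [ramp_apply]; positivity

theorem ramp_le_one (hT : 0 < T) (t : Icc (0 : ℝ) T) (m : ℕ) (s : Icc (0 : ℝ) T) :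
    (ramp hT t m).toFun s ≤ 1 := min_le_left _ _

theorem ramp_monotone (hT : 0 < T) (t : Icc (0 : ℝ) T) (m : ℕ) :
    Monotone (ramp hT t m).toFun := by
  intro s u hsu
  have : (s : ℝ) ≤ u := hsu
  rw [ramp_apply, ramp_apply]
  gcongr

theorem ramp_antitone_left (hT : 0 < T) {t u : Icc (0 : ℝ) T} (htu : t ≤ u) (m : ℕ)
    (s : Icc (0 : ℝ) T) : (ramp hT u m).toFun s ≤ (ramp hT t m).toFun s := by
  have : (t : ℝ) ≤ u := htu
  rw [ramp_apply, ramp_apply]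
  gcongr

theorem totalVariation_ramp_le (hT : 0 < T) (t : Icc (0 : ℝ) T) (m : ℕ) :
    totalVariation hT (ramp hT t m).toFun ≤ 1 := by
  rw [totalVariation_of_monotone hT (ramp_monotone hT t m) (ramp_nonneg hT t m _),
    ENNReal.ofReal_le_one]
  exact ramp_le_one hT t m _

theorem tendsto_ramp (hT : 0 < T) (t s : Icc (0 : ℝ) T) :
    Tendsto (fun m => (ramp hT t m).toFun s) atTop (𝓝 (1 - unitJump s t)) := by
  by_cases h : s ≤ t
  · have h' : (s : ℝ) ≤ t := h
    refine tendsto_const_nhds.congr fun m => ?_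
    rw [ramp_apply, max_eq_left (mul_nonpos_of_nonneg_of_nonpos m.cast_nonneg (sub_nonpos.2 h')),
      unitJump, if_pos h]
    norm_num
  · have h' : (0 : ℝ) < s - t := sub_pos.2 (not_le.1 h)
    have hlim : Tendsto (fun m : ℕ => (m : ℝ) * ((s : ℝ) - t)) atTop atTop :=
      tendsto_natCast_atTop_atTop.atTop_mul_const h'
    refine tendsto_const_nhds.congr' ?_
    filter_upwards [hlim.eventually_ge_atTop 1] with m hm
    rw [ramp_apply, unitJump, if_neg h, min_eq_left (hm.trans (le_max_right _ _)), sub_zero]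

theorem tendsto_integralAgainst_ramp (hT : 0 < T) (x : SkorokhodSpace T) {t : Icc (0 : ℝ) T}
    (ht : t < final hT) :
    Tendsto (fun m => integralAgainst x (ramp hT t m)) atTop (𝓝 (x t)) := by
  refine tendsto_of_forall_approx fun ε hε => ?_
  obtain ⟨K, p, h⟩ := exists_stepFV_near hT x hε
  refine ⟨fun m => integralAgainst (stepFV hT K p).toSkorokhodSpace (ramp hT t m),
    (stepFV hT K p).toFun t, ?_, fun m => ?_, h t⟩
  · have hs : (stepFV hT K p).toFun t =
        (stepFV hT K p).toFun (final hT) * (1 - unitJump (final hT) t) -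
          ∑ k ∈ Finset.range K, (p k).2 * (1 - unitJump (p k).1 t) := by
      rw [unitJump, if_neg (not_le.2 ht), stepFV_apply, stepFV_apply, sub_zero, mul_one,
        ← Finset.sum_sub_distrib]
      refine Finset.sum_congr rfl fun k _ => ?_
      rw [unitJump, unitJump, if_pos (le_final hT _)]
      ring
    rw [hs]
    have hint : ∀ m, integralAgainst (stepFV hT K p).toSkorokhodSpace (ramp hT t m) =
        (stepFV hT K p).toFun (final hT) * (ramp hT t m).toFun (final hT) -
          ∑ k ∈ Finset.range K, (p k).2 * (ramp hT t m).toFun (p k).1 := by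
      intro m
      rw [FiniteVariation.integralAgainst_eq, stieltjesIntegral_stepFV hT K p
        (ramp hT t m).continuous_toFun.measurable
        (abs_le_totalVariation (ramp hT t m).finite_variation)]
    simp only [hint]
    exact ((tendsto_ramp hT t _).const_mul _).sub
      (tendsto_finsetSum _ fun k _ => (tendsto_ramp hT t _).const_mul _)
  · refine (abs_integralAgainst_sub_le x _ _ h).trans ?_
    have : (totalVariation hT (ramp hT t m).toFun).toReal ≤ 1 :=
      ENNReal.toReal_le_of_le_ofReal zero_le_one (by simpa using totalVariation_ramp_le hT t m)
    calc _ ≤ ε * 1 := by gcongr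
      _ = ε := mul_one ε

theorem eq_of_integralAgainst_eq (hT : 0 < T) {x y : SkorokhodSpace T}
    (hf : x (final hT) = y (final hT))
    (h : ∀ A : ContinuousFV hT, integralAgainst x A = integralAgainst y A) : x = y := by
  have : x.toFun = y.toFun := by
    funext t
    rcases (le_final hT t).eq_or_lt with ht | ht
    · rw [ht, hf]
    · refine tendsto_nhds_unique (tendsto_integralAgainst_ramp hT x ht) ?_
      simp only [h]
      exact tendsto_integralAgainst_ramp hT y ht
  cases x; cases y; congr

/-! ### `S`-convergence implies convergence of the integrals -/

/-- The functional `f ↦ ∫ f dv` on `C([0,T])`. -/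
noncomputable def FiniteVariation.toDual {hT : 0 < T} (v : FiniteVariation hT) :
    C(Icc (0 : ℝ) T, ℝ) →L[ℝ] ℝ :=
  LinearMap.mkContinuous
    { toFun := fun f => stieltjesIntegral hT f v.toFun v.finite_variation
      map_add' := fun f g => by
        have hf : ∀ (f : C(Icc (0 : ℝ) T, ℝ)) (ρ : SignedMeasure (Icc (0 : ℝ) T)),
            ρ.Integrable f := fun f ρ =>
          Integrable.of_bound f.continuous.measurable.aestronglyMeasurable ‖f‖
            (Eventually.of_forall f.norm_coe_le_norm)
        simp only [stieltjesIntegral, ContinuousMap.add_apply]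
        rw [VectorMeasure.integral_fun_add (hf f _) (hf g _)]
        ring
      map_smul' := fun c f => by
        simp only [stieltjesIntegral, ContinuousMap.smul_apply]
        rw [VectorMeasure.integral_fun_smul]
        simp only [smul_eq_mul, RingHom.id_apply]
        ring }
    (totalVariation hT v.toFun).toReal fun f =>
      (abs_stieltjesIntegral_le v.finite_variation v.right_continuous f.continuous.measurable
        f.norm_coe_le_norm).trans_eq (mul_comm _ _)

theorem FiniteVariation.toDual_apply {hT : 0 < T} (v : FiniteVariation hT)
    (f : C(Icc (0 : ℝ) T, ℝ)) :
    v.toDual f = stieltjesIntegral hT f v.toFun v.finite_variation := rfl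

/-- By the uniform boundedness principle, a weak-* convergent sequence is bounded in the dual of
`C([0,T])`; so it may be tested on uniformly convergent sequences of functions. -/
theorem WeakStarConv.tendsto_stieltjesIntegral {hT : 0 < T} {v : ℕ → FiniteVariation hT}
    {v₀ : FiniteVariation hT} (h : WeakStarConv v v₀) {f : ℕ → C(Icc (0 : ℝ) T, ℝ)}
    {f₀ : C(Icc (0 : ℝ) T, ℝ)} (hf : Tendsto f atTop (𝓝 f₀)) :
    Tendsto (fun n => stieltjesIntegral hT (f n) (v n).toFun (v n).finite_variation) atTop
      (𝓝 (stieltjesIntegral hT f₀ v₀.toFun v₀.finite_variation)) := by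
  obtain ⟨C, hC⟩ := banach_steinhaus (g := fun n => (v n).toDual) fun g => by
    obtain ⟨C, hC⟩ := (h g g.continuous).norm.bddAbove_range
    exact ⟨C, fun n => hC ⟨n, rfl⟩⟩
  have h1 : Tendsto (fun n => (v n).toDual (f n - f₀)) atTop (𝓝 0) := by
    refine squeeze_zero_norm (a := fun n => C * ‖f n - f₀‖) (fun n => ?_) ?_
    · exact ((v n).toDual.le_opNorm _).trans
        (mul_le_mul_of_nonneg_right (hC n) (norm_nonneg _))
    · have := (tendsto_iff_norm_sub_tendsto_zero.1 hf).const_mul C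
      rwa [mul_zero] at this
  have h2 := h1.add (h f₀ f₀.continuous)
  rw [zero_add] at h2
  refine h2.congr fun n => ?_
  rw [map_sub, FiniteVariation.toDual_apply, FiniteVariation.toDual_apply]
  ring

theorem WeakStarConv.tendsto_final {hT : 0 < T} {v : ℕ → FiniteVariation hT}
    {v₀ : FiniteVariation hT} (h : WeakStarConv v v₀) :
    Tendsto (fun n => (v n).toFun (final hT)) atTop (𝓝 (v₀.toFun (final hT))) := by
  have hone : ∀ v : FiniteVariation hT,
      stieltjesIntegral hT (fun _ => 1) v.toFun v.finite_variation = v.toFun (final hT) := by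
    intro v
    rw [stieltjesIntegral_eq v.finite_variation measurable_const (C := 1) (by simp),
      VectorMeasure.integral_const, stieltjesMeasure_univ v.finite_variation v.right_continuous]
    simp
  simpa only [hone] using h (fun _ => 1) continuous_const

theorem TauConv.exists_bound {hT : 0 < T} {A : ℕ → ContinuousFV hT} {A₀ : ContinuousFV hT}
    (h : TauConv A A₀) : ∃ M : ℝ, 0 ≤ M ∧ ∀ n, (totalVariation hT (A n).toFun).toReal ≤ M :=
  ⟨_, ENNReal.toReal_nonneg, fun n => ENNReal.toReal_mono h.2.ne
    (le_iSup (fun n => totalVariation hT (A n).toFun) n)⟩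

/-- `∫ vₙ dAₙ = vₙ(T) Aₙ(T) - ∫ Aₙ dvₙ`, and both terms converge. -/
theorem WeakStarConv.tendsto_integralAgainst {hT : 0 < T} {v : ℕ → FiniteVariation hT}
    {v₀ : FiniteVariation hT} (h : WeakStarConv v v₀) {A : ℕ → ContinuousFV hT}
    {A₀ : ContinuousFV hT} (hA : TauConv A A₀) :
    Tendsto (fun n => integralAgainst (v n).toSkorokhodSpace (A n)) atTop
      (𝓝 (integralAgainst v₀.toSkorokhodSpace A₀)) := by
  simp only [FiniteVariation.integralAgainst_eq]
  refine (h.tendsto_final.mul (hA.1.tendsto_at _)).sub ?_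
  have hlim : Tendsto (fun n => (⟨(A n).toFun, (A n).continuous_toFun⟩ : C(Icc (0 : ℝ) T, ℝ)))
      atTop (𝓝 ⟨A₀.toFun, A₀.continuous_toFun⟩) :=
    ContinuousMap.tendsto_iff_tendstoUniformly.2 hA.1
  exact h.tendsto_stieltjesIntegral hlim

theorem SConv.tendsto_final {hT : 0 < T} {x : ℕ → SkorokhodSpace T} {x₀ : SkorokhodSpace T}
    (h : SConv hT x x₀) : Tendsto (fun n => x n (final hT)) atTop (𝓝 (x₀ (final hT))) := by
  refine tendsto_of_forall_approx fun ε hε => ?_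
  obtain ⟨v, v₀, h1, h2, h3⟩ := h ε hε
  exact ⟨_, _, h3.tendsto_final, fun n => h1 n _, h2 _⟩

/-- Replacing `xₙ` by `vₙ` costs an error of at most `ε ‖Aₙ‖(T)`, which is small
uniformly in `n`. -/
theorem SConv.tendsto_integralAgainst {hT : 0 < T} {x : ℕ → SkorokhodSpace T}
    {x₀ : SkorokhodSpace T} (h : SConv hT x x₀) {A : ℕ → ContinuousFV hT} {A₀ : ContinuousFV hT}
    (hA : TauConv A A₀) :
    Tendsto (fun n => integralAgainst (x n) (A n)) atTop (𝓝 (integralAgainst x₀ A₀)) := by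
  obtain ⟨M, hM0, hM⟩ := hA.exists_bound
  set M₀ := (totalVariation hT A₀.toFun).toReal
  have hM₀0 : 0 ≤ M₀ := ENNReal.toReal_nonneg
  refine tendsto_of_forall_approx fun ε hε => ?_
  obtain ⟨v, v₀, h1, h2, h3⟩ := h (ε / (M + M₀ + 1)) (by positivity)
  have hle : ∀ L, 0 ≤ L → L ≤ M + M₀ → ε / (M + M₀ + 1) * L ≤ ε := by
    intro L hL hL'
    rw [div_mul_eq_mul_div, div_le_iff₀ (by positivity)]
    gcongr
    linarith
  refine ⟨_, _, h3.tendsto_integralAgainst hA, fun n => ?_, ?_⟩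
  · exact (abs_integralAgainst_sub_le _ _ _ (h1 n)).trans
      (hle _ ENNReal.toReal_nonneg (by linarith [hM n]))
  · exact (abs_integralAgainst_sub_le _ _ _ h2).trans (hle _ hM₀0 (by linarith))

theorem tauConv_const {hT : 0 < T} (A : ContinuousFV hT) : TauConv (fun _ => A) A :=
  ⟨Metric.tendstoUniformly_iff.2 fun ε hε => Eventually.of_forall fun _ _ => by simpa using hε,
    by simpa using A.finite_variation⟩

theorem sConv_const (hT : 0 < T) (x : SkorokhodSpace T) : SConv hT (fun _ => x) x := by
  intro ε hε
  obtain ⟨K, p, h⟩ := exists_stepFV_near hT x hε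
  exact ⟨fun _ => stepFV hT K p, stepFV hT K p, fun _ => h, h, fun f _ => tendsto_const_nhds⟩

/-! ### Convergence in the `S` topology and `S`-convergence of subsequences -/

theorem SStarConv.tendsto_of_sequentiallyContinuous {hT : 0 < T} {x : ℕ → SkorokhodSpace T}
    {x₀ : SkorokhodSpace T} (h : SStarConv hT x x₀) {f : SkorokhodSpace T → ℝ}
    (hf : ∀ y y₀, SConv hT y y₀ → Tendsto (fun n => f (y n)) atTop (𝓝 (f y₀))) :
    Tendsto (fun n => f (x n)) atTop (𝓝 (f x₀)) := by
  let := sTopology hT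
  have hc : Continuous f := by
    refine continuous_def.2 fun U hU => ?_
    change SClosed hT (f ⁻¹' U)ᶜ
    intro y y₀ hy hconv
    exact hU.isClosed_compl.mem_of_tendsto (hf y y₀ hconv) (Eventually.of_forall hy)
  exact (hc.tendsto x₀).comp h

theorem SClosed.mem_of_sStarConv {hT : 0 < T} {F : Set (SkorokhodSpace T)} (hF : SClosed hT F)
    {x : ℕ → SkorokhodSpace T} {x₀ : SkorokhodSpace T} (h : SStarConv hT x x₀)
    (hx : ∃ᶠ n in atTop, x n ∈ F) : x₀ ∈ F := by
  let := sTopology hT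
  by_contra hcon
  have hopen : IsOpen Fᶜ := by
    change SClosed hT Fᶜᶜ
    rwa [compl_compl]
  exact hx (h.eventually (hopen.mem_nhds hcon))

theorem SConv.eq_of_const {hT : 0 < T} {y z : SkorokhodSpace T} (h : SConv hT (fun _ => y) z) :
    y = z :=
  eq_of_integralAgainst_eq hT (tendsto_nhds_unique tendsto_const_nhds h.tendsto_final) fun A =>
    tendsto_nhds_unique tendsto_const_nhds (h.tendsto_integralAgainst (tauConv_const A))

/-- A sequence converging in the `S` topology has an `S`-convergent subsequence. Otherwise a tail
of the sequence is an `S`-closed set that does not contain the limit: limits of `S`-convergent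
subsequences are determined by the functionals `x ↦ ∫ x dA` and `x ↦ x(T)`, which are continuous
for the `S` topology. -/
theorem SStarConv.exists_subseq_sConv {hT : 0 < T} {x : ℕ → SkorokhodSpace T}
    {x₀ : SkorokhodSpace T} (h : SStarConv hT x x₀) :
    ∃ φ : ℕ → ℕ, StrictMono φ ∧ SConv hT (fun k => x (φ k)) x₀ := by
  by_contra! hcon
  have hne : ∀ᶠ n in atTop, x n ≠ x₀ := by
    by_contra hfreq
    obtain ⟨φ, hφ, hx⟩ := extraction_of_frequently_atTop (not_eventually.1 hfreq)
    refine hcon φ hφ ?_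
    have : (fun k => x (φ k)) = fun _ => x₀ := funext fun k => not_not.1 (hx k)
    rw [this]
    exact sConv_const hT x₀
  obtain ⟨N, hN⟩ := eventually_atTop.1 hne
  have hclosed : SClosed hT (x '' Ici N) := by
    intro z z₀ hz hconv
    choose k hk hkz using hz
    by_cases hc : ∃ c, ∃ᶠ j in atTop, k j = c
    · obtain ⟨c, hc⟩ := hc
      obtain ⟨φ, hφ, hφc⟩ := extraction_of_frequently_atTop hc
      have hsub := hconv.subseq hφ
      have : (fun j => z (φ j)) = fun _ => x c := funext fun j => by rw [← hkz, hφc]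
      rw [this] at hsub
      rw [← hsub.eq_of_const]
      exact ⟨c, hφc 0 ▸ hk _, rfl⟩
    · have hk_lim : Tendsto k atTop cofinite := by
        refine le_cofinite_iff_eventually_ne.2 fun c => eventually_map.2 ?_
        by_contra hcf
        exact hc ⟨c, by simpa using not_eventually.1 hcf⟩
      rw [Nat.cofinite_eq_atTop] at hk_lim
      obtain ⟨φ, hφ, hkφ⟩ := strictMono_subseq_of_tendsto_atTop hk_lim
      have hsub : SConv hT (fun j => x (k (φ j))) z₀ := by
        have := hconv.subseq hφ
        simpa only [hkz] using this
      have hz₀ : z₀ = x₀ := by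
        refine eq_of_integralAgainst_eq hT ?_ fun A => ?_
        · exact tendsto_nhds_unique hsub.tendsto_final
            ((h.tendsto_of_sequentiallyContinuous (f := fun y => y (final hT))
              fun _ _ hy => hy.tendsto_final).comp hkφ.tendsto_atTop)
        · exact tendsto_nhds_unique (hsub.tendsto_integralAgainst (tauConv_const A))
            ((h.tendsto_of_sequentiallyContinuous (f := fun y => integralAgainst y A)
              fun _ _ hy => hy.tendsto_integralAgainst (tauConv_const A)).comp
                hkφ.tendsto_atTop)
      exact absurd (hz₀ ▸ hsub) (hcon _ hkφ)
  obtain ⟨n, hn, hxn⟩ := hclosed.mem_of_sStarConv h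
    (eventually_atTop.2 ⟨N, fun n hn => ⟨n, hn, rfl⟩⟩).frequently
  exact hN n hn hxn

theorem SStarConv.subseq {hT : 0 < T} {x : ℕ → SkorokhodSpace T} {x₀ : SkorokhodSpace T}
    (h : SStarConv hT x x₀) {φ : ℕ → ℕ} (hφ : Tendsto φ atTop atTop) :
    SStarConv hT (fun k => x (φ k)) x₀ :=
  Tendsto.comp h hφ

theorem sStarConv_of_forall_subseq {hT : 0 < T} {x : ℕ → SkorokhodSpace T} {x₀ : SkorokhodSpace T}
    (h : ∀ φ : ℕ → ℕ, StrictMono φ →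
      ∃ ψ : ℕ → ℕ, StrictMono ψ ∧ SConv hT (fun k => x (φ (ψ k))) x₀) :
    SStarConv hT x x₀ := by
  let := sTopology hT
  refine tendsto_nhds.2 fun U hU hx₀ => ?_
  by_contra hcon
  obtain ⟨φ, hφ, hφU⟩ := extraction_of_frequently_atTop (not_eventually.1 hcon)
  obtain ⟨ψ, -, hψ⟩ := h φ hφ
  exact (show SClosed hT Uᶜ from hU) _ x₀ (fun k => hφU (ψ k)) hψ hx₀

theorem SStarConv.tendsto_final {hT : 0 < T} {x : ℕ → SkorokhodSpace T} {x₀ : SkorokhodSpace T}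
    (h : SStarConv hT x x₀) : Tendsto (fun n => x n (final hT)) atTop (𝓝 (x₀ (final hT))) :=
  h.tendsto_of_sequentiallyContinuous (f := fun y => y (final hT)) fun _ _ hy => hy.tendsto_final

theorem TauConv.comp {hT : 0 < T} {A : ℕ → ContinuousFV hT} {A₀ : ContinuousFV hT}
    (h : TauConv A A₀) {φ : ℕ → ℕ} (hφ : Tendsto φ atTop atTop) :
    TauConv (fun k => A (φ k)) A₀ :=
  ⟨fun u hu => hφ.eventually (h.1 u hu),
    (iSup_le fun k => le_iSup (fun n => totalVariation hT (A n).toFun) (φ k)).trans_lt h.2⟩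

theorem SStarConv.tendsto_integralAgainst {hT : 0 < T} {x : ℕ → SkorokhodSpace T}
    {x₀ : SkorokhodSpace T} (h : SStarConv hT x x₀) {A : ℕ → ContinuousFV hT}
    {A₀ : ContinuousFV hT} (hA : TauConv A A₀) :
    Tendsto (fun n => integralAgainst (x n) (A n)) atTop (𝓝 (integralAgainst x₀ A₀)) := by
  refine tendsto_of_subseq_tendsto fun φ hφ => ?_
  obtain ⟨ψ, hψ, hconv⟩ := (h.subseq hφ).exists_subseq_sConv
  exact ⟨ψ, hconv.tendsto_integralAgainst (hA.comp (hφ.comp hψ.tendsto_atTop))⟩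

end SkorokhodSpace

/-! ### Consequences of the convergence of all integrals -/

/-- A bound holding for each index and, uniformly, for all large indices, holds uniformly. -/
theorem exists_forall_of_eventually {α : Type*} [LinearOrder α] [Nonempty α] {P : ℕ → α → Prop}
    (hmono : ∀ n a b, a ≤ b → P n a → P n b) (h : ∀ n, ∃ a, P n a)
    (hev : ∃ a, ∀ᶠ n in atTop, P n a) : ∃ a, ∀ n, P n a := by
  choose c hc using h
  obtain ⟨a, ha⟩ := hev
  obtain ⟨N, hN⟩ := eventually_atTop.1 ha
  obtain ⟨b, hb⟩ := ((Finset.range N).image c).exists_le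
  refine ⟨max a b, fun n => ?_⟩
  rcases le_or_gt N n with hn | hn
  · exact hmono n _ _ (le_max_left _ _) (hN n hn)
  · exact hmono n _ _ ((hb _ (Finset.mem_image_of_mem c (Finset.mem_range.2 hn))).trans
      (le_max_right _ _)) (hc n)

namespace SkorokhodSpace

variable {T : ℝ}

noncomputable instance {hT : 0 < T} : Zero (ContinuousFV hT) :=
  ⟨ContinuousFV.sum (∅ : Finset Empty) Empty.elim Empty.elim⟩

theorem integralAgainst_zero {hT : 0 < T} (x : SkorokhodSpace T) :
    integralAgainst x (0 : ContinuousFV hT) = 0 :=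
  (integralAgainst_sum _ _ _ x).trans Finset.sum_empty

theorem ContinuousFV.zero_apply {hT : 0 < T} (t : Icc (0 : ℝ) T) :
    (0 : ContinuousFV hT).toFun t = 0 := by
  change (ContinuousFV.sum (∅ : Finset Empty) Empty.elim Empty.elim).toFun t = 0
  simp [ContinuousFV.sum]

/-- Joint convergence `∫ xₙ dAₙ → ∫ x₀ dA₀` along all `τ`-convergent sequences in `𝔸`. -/
def IntegralConv (hT : 0 < T) (x : ℕ → SkorokhodSpace T) (x₀ : SkorokhodSpace T) : Prop :=
  ∀ (A : ℕ → ContinuousFV hT) (A₀ : ContinuousFV hT), TauConv A A₀ →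
    Tendsto (fun n => integralAgainst (x n) (A n)) atTop (𝓝 (integralAgainst x₀ A₀))

theorem TauConv.extend {hT : 0 < T} {A : ℕ → ContinuousFV hT} {A₀ : ContinuousFV hT}
    (h : TauConv A A₀) {φ : ℕ → ℕ} (hφ : StrictMono φ) :
    TauConv (Function.extend φ A fun _ => A₀) A₀ := by
  constructor
  · rw [Metric.tendstoUniformly_iff]
    intro ε hε
    obtain ⟨N, hN⟩ := eventually_atTop.1 (Metric.tendstoUniformly_iff.1 h.1 ε hε)
    filter_upwards [eventually_ge_atTop (φ N)] with m hm t
    by_cases hr : ∃ k, φ k = m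
    · obtain ⟨k, rfl⟩ := hr
      rw [hφ.injective.extend_apply]
      exact hN k (hφ.le_iff_le.1 hm) t
    · rw [Function.extend_apply' _ _ _ hr, dist_self]
      exact hε
  · refine lt_of_le_of_lt (iSup_le (a := max (⨆ n, totalVariation hT (A n).toFun)
      (totalVariation hT A₀.toFun)) fun m => ?_) (max_lt h.2 A₀.finite_variation)
    by_cases hr : ∃ k, φ k = m
    · obtain ⟨k, rfl⟩ := hr
      rw [hφ.injective.extend_apply]
      exact (le_iSup (fun n => totalVariation hT (A n).toFun) k).trans (le_max_left _ _)
    · rw [Function.extend_apply' _ _ _ hr]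
      exact le_max_right _ _

theorem IntegralConv.subseq {hT : 0 < T} {x : ℕ → SkorokhodSpace T} {x₀ : SkorokhodSpace T}
    (h : IntegralConv hT x x₀) {φ : ℕ → ℕ} (hφ : StrictMono φ) :
    IntegralConv hT (fun k => x (φ k)) x₀ := by
  intro A A₀ hA
  refine ((h _ A₀ (hA.extend hφ)).comp hφ.tendsto_atTop).congr fun k => ?_
  rw [Function.comp_apply, hφ.injective.extend_apply]

/-- Convergence along sequences `Aₙ →_τ 0` is an equicontinuity property: `∫ xₙ dA` is small,
uniformly in large `n`, for all uniformly small `A` of bounded variation. -/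
theorem IntegralConv.eventually_small {hT : 0 < T} {x : ℕ → SkorokhodSpace T}
    {x₀ : SkorokhodSpace T} (h : IntegralConv hT x x₀) {M : ℝ≥0∞} (hM : M < ∞) {η : ℝ}
    (hη : 0 < η) :
    ∃ δ : ℝ, 0 < δ ∧ ∀ᶠ n in atTop, ∀ A : ContinuousFV hT, (∀ t, |A.toFun t| ≤ δ) →
      totalVariation hT A.toFun ≤ M → |integralAgainst (x n) A| ≤ η := by
  by_contra! hcon
  have hex : ∀ j : ℕ, ∃ n, j ≤ n ∧ ∃ A : ContinuousFV hT, (∀ t, |A.toFun t| ≤ 1 / ((j : ℝ) + 1)) ∧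
      totalVariation hT A.toFun ≤ M ∧ η < |integralAgainst (x n) A| := by
    intro j
    obtain ⟨n, hn, hA⟩ := frequently_atTop.1 (hcon _ (Nat.one_div_pos_of_nat (n := j))) j
    exact ⟨n, hn, hA⟩
  choose n hn B hB1 hB2 hB3 using hex
  obtain ⟨φ, hφ, hnφ⟩ := strictMono_subseq_of_tendsto_atTop (tendsto_atTop_mono hn tendsto_id)
  have hτ : TauConv B 0 := by
    refine ⟨Metric.tendstoUniformly_iff.2 fun ε hε => ?_, (iSup_le hB2).trans_lt hM⟩
    filter_upwards [(tendsto_one_div_add_atTop_nhds_zero_nat (𝕜 := ℝ)).eventually_lt_const hε]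
      with j hj t
    rw [ContinuousFV.zero_apply, dist_comm, Real.dist_eq, sub_zero]
    exact (hB1 j t).trans_lt hj
  have hlim := (h.subseq hnφ _ _ (hτ.comp hφ.tendsto_atTop)).abs
  rw [integralAgainst_zero, abs_zero] at hlim
  obtain ⟨k, hk⟩ := (hlim.eventually_lt_const hη).exists
  exact absurd hk (not_lt.2 (hB3 (φ k)).le)

/-- Testing against small multiples of ramps starting at `t` bounds `x t`. -/
theorem IntegralConv.exists_bound {hT : 0 < T} {x : ℕ → SkorokhodSpace T} {x₀ : SkorokhodSpace T}
    (h : IntegralConv hT x x₀)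
    (hfin : Tendsto (fun n => x n (final hT)) atTop (𝓝 (x₀ (final hT)))) :
    ∃ C, ∀ n t, |x n t| ≤ C := by
  refine exists_forall_of_eventually (P := fun n C => ∀ t, |x n t| ≤ C)
    (fun n a b hab ha t => (ha t).trans hab) (fun n => (x n).exists_bound hT) ?_
  obtain ⟨D, hD⟩ := hfin.abs.bddAbove_range
  obtain ⟨δ, hδ, hev⟩ := h.eventually_small (M := ‖(1 : ℝ)‖ₑ) (by simp) one_pos
  set c := min δ 1 with hc
  have hc0 : 0 < c := lt_min hδ one_pos
  refine ⟨max (1 / c) D, ?_⟩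
  filter_upwards [hev] with n hn t
  rcases (le_final hT t).eq_or_lt with ht | ht
  · rw [ht]
    exact (hD ⟨n, rfl⟩).trans (le_max_right _ _)
  · refine le_trans ?_ (le_max_left _ _)
    rw [le_div_iff₀' hc0, ← abs_of_pos hc0, ← abs_mul]
    refine le_of_tendsto ((tendsto_integralAgainst_ramp hT (x n) ht).const_mul c).abs
      (Eventually.of_forall fun m => ?_)
    have hsmall := hn (ContinuousFV.sum {m} (fun _ => c) (ramp hT t)) (fun s => ?_) ?_
    · simpa only [integralAgainst_sum, Finset.sum_singleton] using hsmall
    · simp only [ContinuousFV.sum, Finset.sum_singleton]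
      rw [abs_mul, abs_of_pos hc0, abs_of_nonneg (ramp_nonneg hT t m s)]
      calc c * (ramp hT t m).toFun s ≤ δ * 1 :=
            mul_le_mul (min_le_left _ _) (ramp_le_one hT t m s) (ramp_nonneg hT t m s) hδ.le
        _ = δ := mul_one δ
    · refine (totalVariation_sum_le hT {m} (fun _ => c) fun m => (ramp hT t m).toFun).trans ?_
      rw [Finset.sum_singleton]
      calc ‖c‖ₑ * totalVariation hT (ramp hT t m).toFun ≤ ‖(1 : ℝ)‖ₑ * 1 := by
            refine mul_le_mul' ?_ (totalVariation_ramp_le hT t m)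
            rw [Real.enorm_eq_ofReal hc0.le, Real.enorm_eq_ofReal zero_le_one]
            exact ENNReal.ofReal_le_ofReal (min_le_right _ _)
        _ = _ := mul_one _

/-- A function of variation at most `2` against which integration approximates the increment
`x u - x t`. -/
noncomputable def rampDiff (hT : 0 < T) (t u : Icc (0 : ℝ) T) (m : ℕ) : ContinuousFV hT :=
  ContinuousFV.sum Finset.univ (fun b : Bool => if b then 1 else -1)
    (fun b => if b then ramp hT u m else ramp hT t m)

theorem rampDiff_apply (hT : 0 < T) (t u : Icc (0 : ℝ) T) (m : ℕ) (s : Icc (0 : ℝ) T) :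
    (rampDiff hT t u m).toFun s = (ramp hT u m).toFun s - (ramp hT t m).toFun s := by
  simp [rampDiff, ContinuousFV.sum, sub_eq_add_neg]

theorem integralAgainst_rampDiff (hT : 0 < T) (t u : Icc (0 : ℝ) T) (m : ℕ)
    (x : SkorokhodSpace T) :
    integralAgainst x (rampDiff hT t u m) =
      integralAgainst x (ramp hT u m) - integralAgainst x (ramp hT t m) := by
  rw [rampDiff, integralAgainst_sum]
  simp [sub_eq_add_neg]

theorem totalVariation_rampDiff_le (hT : 0 < T) (t u : Icc (0 : ℝ) T) (m : ℕ) :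
    totalVariation hT (rampDiff hT t u m).toFun ≤ 2 := by
  refine (totalVariation_sum_le hT Finset.univ (fun b : Bool => if b then 1 else -1) fun b =>
    (if b then ramp hT u m else ramp hT t m).toFun).trans ?_
  simp only [Fintype.sum_bool, if_true, Bool.false_eq_true, if_false, enorm_one, enorm_neg,
    one_mul]
  exact (add_le_add (totalVariation_ramp_le hT u m) (totalVariation_ramp_le hT t m)).trans_eq
    one_add_one_eq_two

/-- The number of `ε`-crossings is bounded uniformly in `n`. If `τ₀ < ⋯ < τ_K < T` are crossing
times of `xₙ`, then integration of `xₙ` against the functions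
`K⁻¹ ∑ₖ ± (rampDiff from τₖ to τₖ₊₁)` approximates `K⁻¹ ∑ₖ |xₙ(τₖ₊₁) - xₙ(τₖ)| ≥ ε`, while these
functions have variation at most `2` and, by telescoping, absolute value at most `K⁻¹`. -/
theorem IntegralConv.exists_crossing_eq_final {hT : 0 < T} {x : ℕ → SkorokhodSpace T}
    {x₀ : SkorokhodSpace T} (h : IntegralConv hT x x₀) {ε : ℝ} (hε : 0 < ε) :
    ∃ K, ∀ n, crossing hT (x n) hε K = final hT := by
  refine exists_forall_of_eventually (P := fun n K => crossing hT (x n) hε K = final hT)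
    (fun n a b hab ha => (le_final hT _).antisymm (ha ▸ crossing_monotone hT (x n) hε hab))
    (fun n => SkorokhodSpace.exists_crossing_eq_final hT (x n) hε) ?_
  obtain ⟨δ, hδ, hev⟩ := h.eventually_small (M := 2) (by simp) (half_pos hε)
  obtain ⟨K', hK'⟩ := exists_nat_one_div_lt hδ
  set K := K' + 1 with hK
  have hKpos : (0 : ℝ) < K := by positivity
  have hKδ : (K : ℝ)⁻¹ ≤ δ := by
    rw [inv_eq_one_div, hK]
    push_cast
    exact hK'.le
  refine ⟨K, ?_⟩
  filter_upwards [hev] with n hn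
  by_contra hne
  set τ := crossing hT (x n) hε with hτ
  have hmono : Monotone τ := crossing_monotone hT (x n) hε
  have hlt : ∀ k ≤ K, τ k < final hT := fun k hk =>
    (hmono hk).trans_lt ((le_final hT _).lt_of_ne hne)
  set c : ℕ → ℝ := fun k => if 0 ≤ x n (τ (k + 1)) - x n (τ k) then (K : ℝ)⁻¹ else -(K : ℝ)⁻¹
    with hc
  have hcabs : ∀ k, |c k| = (K : ℝ)⁻¹ := by
    intro k
    have : |(K : ℝ)⁻¹| = (K : ℝ)⁻¹ := abs_of_pos (inv_pos.2 hKpos)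
    simp only [hc]
    split_ifs
    · exact this
    · rw [abs_neg, this]
  have hcmul : ∀ k, c k * (x n (τ (k + 1)) - x n (τ k)) =
      (K : ℝ)⁻¹ * |x n (τ (k + 1)) - x n (τ k)| := by
    intro k
    simp only [hc]
    split_ifs with h0
    · rw [abs_of_nonneg h0]
    · rw [abs_of_neg (not_le.1 h0)]
      ring
  have hlim : Tendsto (fun m => ∑ k ∈ Finset.range K,
      c k * integralAgainst (x n) (rampDiff hT (τ k) (τ (k + 1)) m)) atTop
      (𝓝 (∑ k ∈ Finset.range K, c k * (x n (τ (k + 1)) - x n (τ k)))) := by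
    refine tendsto_finsetSum _ fun k hk => Tendsto.const_mul _ ?_
    rw [Finset.mem_range] at hk
    simp only [integralAgainst_rampDiff]
    exact (tendsto_integralAgainst_ramp hT (x n) (hlt _ hk)).sub
      (tendsto_integralAgainst_ramp hT (x n) (hlt _ hk.le))
  have hge : ε ≤ ∑ k ∈ Finset.range K, c k * (x n (τ (k + 1)) - x n (τ k)) := by
    calc ε = ∑ k ∈ Finset.range K, (K : ℝ)⁻¹ * ε := by
          rw [Finset.sum_const, Finset.card_range, nsmul_eq_mul, mul_inv_cancel_left₀ hKpos.ne']
      _ ≤ _ := by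
          refine Finset.sum_le_sum fun k hk => ?_
          rw [hcmul]
          gcongr
          exact (crossing_succ_spec hT (x n) hε k).2.2.2 (hlt _ (Finset.mem_range.1 hk))
  have hle : |∑ k ∈ Finset.range K, c k * (x n (τ (k + 1)) - x n (τ k))| ≤ ε / 2 := by
    refine le_of_tendsto hlim.abs (Eventually.of_forall fun m => ?_)
    rw [← integralAgainst_sum]
    refine hn _ (fun s => ?_) ?_
    · calc |∑ k ∈ Finset.range K, c k * (rampDiff hT (τ k) (τ (k + 1)) m).toFun s|
          ≤ ∑ k ∈ Finset.range K, |c k * (rampDiff hT (τ k) (τ (k + 1)) m).toFun s| :=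
            Finset.abs_sum_le_sum_abs _ _
        _ = ∑ k ∈ Finset.range K,
            (K : ℝ)⁻¹ * ((ramp hT (τ k) m).toFun s - (ramp hT (τ (k + 1)) m).toFun s) := by
            refine Finset.sum_congr rfl fun k _ => ?_
            rw [abs_mul, hcabs, rampDiff_apply, abs_sub_comm, abs_of_nonneg
              (sub_nonneg.2 (ramp_antitone_left hT (hmono k.le_succ) m s))]
        _ = (K : ℝ)⁻¹ * ((ramp hT (τ 0) m).toFun s - (ramp hT (τ K) m).toFun s) := by
            rw [← Finset.mul_sum, Finset.sum_range_sub' fun k => (ramp hT (τ k) m).toFun s]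
        _ ≤ (K : ℝ)⁻¹ * 1 := by
            gcongr
            linarith [ramp_le_one hT (τ 0) m s, ramp_nonneg hT (τ K) m s]
        _ ≤ δ := by rwa [mul_one]
    · refine (totalVariation_sum_le hT (Finset.range K) c fun k =>
        (rampDiff hT (τ k) (τ (k + 1)) m).toFun).trans ?_
      calc _ ≤ ∑ k ∈ Finset.range K, ENNReal.ofReal (K : ℝ)⁻¹ * 2 := by
            refine Finset.sum_le_sum fun k _ => ?_
            rw [Real.enorm_eq_ofReal_abs, hcabs]
            gcongr
            exact totalVariation_rampDiff_le hT _ _ m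
        _ = 2 := by
            rw [Finset.sum_const, Finset.card_range, nsmul_eq_mul, ← mul_assoc,
              ENNReal.ofReal_inv_of_pos hKpos, ENNReal.ofReal_natCast,
              ENNReal.mul_inv_cancel (by simp [hK]) (by simp), one_mul]
  linarith [(abs_le.1 hle).2]

/-! ### Compactness -/

/-- For each `ε = 1/(j+1)` the crossing times and increments of the `xₙ` range over a compact
space, and only boundedly many of them enter into the approximating step functions. A diagonal
subsequence makes all of them converge; the limiting step functions are close to `x₀` since they
have the same integrals against ramps, up to `ε`. -/
theorem IntegralConv.exists_subseq_sConv {hT : 0 < T} {x : ℕ → SkorokhodSpace T}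
    {x₀ : SkorokhodSpace T} (h : IntegralConv hT x x₀)
    (hfin : Tendsto (fun n => x n (final hT)) atTop (𝓝 (x₀ (final hT)))) :
    ∃ φ : ℕ → ℕ, StrictMono φ ∧ SConv hT (fun k => x (φ k)) x₀ := by
  obtain ⟨C, hC⟩ := h.exists_bound hfin
  have hpos : ∀ j : ℕ, (0 : ℝ) < 1 / ((j : ℝ) + 1) := fun j => Nat.one_div_pos_of_nat
  choose K hK using fun j => h.exists_crossing_eq_final (hpos j)
  have hmem : ∀ n j k, (crossingJumps hT (x n) (hpos j) k).2 ∈ Icc (-(2 * C)) (2 * C) := by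
    intro n j k
    rw [mem_Icc, ← abs_le]
    unfold crossingJumps
    have hC0 : 0 ≤ C := (abs_nonneg _).trans (hC n (start hT))
    dsimp only
    split_ifs
    · linarith [hC n (start hT)]
    · refine (abs_sub _ _).trans ?_
      linarith [hC n (crossing hT (x n) (hpos j) k), hC n (crossing hT (x n) (hpos j) (k - 1))]
  let p : ℕ → ℕ → ℕ → Icc (0 : ℝ) T × Icc (-(2 * C)) (2 * C) := fun n j k =>
    (crossing hT (x n) (hpos j) k, ⟨_, hmem n j k⟩)
  obtain ⟨a, φ, hφ, hlim⟩ := CompactSpace.tendsto_subseq p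
  have hlim' : ∀ j k, Tendsto (fun n => p (φ n) j k) atTop (𝓝 (a j k)) := fun j k =>
    tendsto_pi_nhds.1 (tendsto_pi_nhds.1 hlim j) k
  refine ⟨φ, hφ, fun ε hε => ?_⟩
  obtain ⟨j, hj⟩ := exists_nat_one_div_lt hε
  have hweak : WeakStarConv
      (fun n => stepFV hT (K j + 1) (crossingJumps hT (x (φ n)) (hpos j)))
      (stepFV hT (K j + 1) fun k => ((a j k).1, ((a j k).2 : ℝ))) := by
    intro f hf
    obtain ⟨D, hD⟩ := isCompact_univ.exists_bound_of_continuousOn hf.continuousOn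
    have hD' : ∀ t, |f t| ≤ D := fun t => hD t (mem_univ t)
    simp only [stieltjesIntegral_stepFV hT _ _ hf.measurable hD']
    refine tendsto_finsetSum _ fun k _ => Tendsto.mul ?_ ?_
    · exact (continuous_subtype_val.tendsto _).comp
        ((continuous_snd.tendsto _).comp (hlim' j k))
    · exact (hf.tendsto _).comp ((continuous_fst.tendsto _).comp (hlim' j k))
  have hnear : ∀ n t, |x (φ n) t -
      (stepFV hT (K j + 1) (crossingJumps hT (x (φ n)) (hpos j))).toFun t| ≤ ε := fun n t =>
    (abs_sub_stepFV_crossingJumps_le hT (x (φ n)) (hpos j) (hK j (φ n)) t).trans hj.le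
  refine ⟨_, _, hnear, fun t => ?_, hweak⟩
  rcases (le_final hT t).eq_or_lt with ht | ht
  · rw [ht]
    exact le_of_tendsto ((hfin.comp hφ.tendsto_atTop).sub hweak.tendsto_final).abs
      (Eventually.of_forall fun n => hnear n _)
  · refine le_of_tendsto ((tendsto_integralAgainst_ramp hT x₀ ht).sub
      (tendsto_integralAgainst_ramp hT _ ht)).abs (Eventually.of_forall fun m => ?_)
    refine le_of_tendsto (((h.subseq hφ) _ _ (tauConv_const (ramp hT t m))).sub
      (hweak.tendsto_integralAgainst (tauConv_const (ramp hT t m)))).abs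
      (Eventually.of_forall fun n => ?_)
    refine (abs_integralAgainst_sub_le _ _ _ (hnear n)).trans ?_
    have : (totalVariation hT (ramp hT t m).toFun).toReal ≤ 1 :=
      ENNReal.toReal_le_of_le_ofReal zero_le_one (by simpa using totalVariation_ramp_le hT t m)
    calc _ ≤ ε * 1 := by gcongr
      _ = ε := mul_one ε

end SkorokhodSpace

theorem theorem3p2 (T : ℝ) (hT : 0 < T)
    (x : ℕ → SkorokhodSpace T) (x₀ : SkorokhodSpace T) :
    SkorokhodSpace.SStarConv hT x x₀ ↔
      (Tendsto (fun n => x n (SkorokhodSpace.final hT)) atTop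
          (𝓝 (x₀ (SkorokhodSpace.final hT))) ∧
        ∀ (A : ℕ → SkorokhodSpace.ContinuousFV hT) (A₀ : SkorokhodSpace.ContinuousFV hT),
          SkorokhodSpace.TauConv A A₀ →
            Tendsto (fun n => SkorokhodSpace.integralAgainst (x n) (A n)) atTop
              (𝓝 (SkorokhodSpace.integralAgainst x₀ A₀))) := by
  refine ⟨fun h => ⟨h.tendsto_final, fun A A₀ hA => h.tendsto_integralAgainst hA⟩, ?_⟩
  rintro ⟨hfin, hint⟩
  refine SkorokhodSpace.sStarConv_of_forall_subseq fun φ hφ => ?_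
  have hint' : SkorokhodSpace.IntegralConv hT x x₀ := hint
  exact (hint'.subseq hφ).exists_subseq_sConv (hfin.comp hφ.tendsto_atTop)
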